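/- **Conventions.** $\mathrm{OG}(4)$ is the family of pairs $(\Gamma,G)$ where $\Gamma$ is a finite simple connected graph of valency $4$ and $G\le \mathrm{Aut}(\Gamma)$ is vertex-transitive and edge-transitive, with a specified $G$-orbit $\Delta$ on ordered vertex-pairs that contains exactly one ordered pair for each edge; an edge $\{x,y\}$ is oriented from $x$ to $y$ if $(x,y)\in\Delta$. For $N\le G$ the graph $\Gamma_N$ has the $N$-orbits as vertices, two distinct orbits being adjacent if some edge of $\Gamma$ joins them; it is a normal quotient of $(\Gamma,G)$ if its vertices are the orbits of a normal subgroup of $G$. It is *cyclic* if it is a cycle $C_k$ with $k\ge3$, and *$G$-oriented* if, for any two distinct orbits, all the edges between them have the same orientation. Cyclic normal quotients $\Gamma_N,\Gamma_M$ are *independent* if $\Gamma_K$ is not a cycle, where $K=\tilde N\cap\tilde M$ and $\tilde N$, $\tilde M$ consist of the elements of $G$ fixing setwise each $N$-orbit, respectively each $M$-orbit. $(\Gamma,G)$ is a *normal cover* of $(\Gamma',G')$ if for some normal subgroup $T$ of $G$, each vertex of a $T$-orbit $B$ is adjacent to exactly one vertex of each $T$-orbit adjacent to $B$ in $\Gamma_T$,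 and there are a graph isomorphism $\Gamma_T\to\Gamma'$ and a compatible group isomorphism $G/T\to G'$. $\Gamma$ is a *weak $(m,n)$-metacirculant* relative to automorphisms $(\rho,\lambda)$ if $\Gamma$ has $mn$ vertices, $\rho$ has $m$ cycles of length $n$ on vertices, $\langle\lambda\rangle$ permutes the $\rho$-cycles transitively, and $\rho^\lambda=\rho^t$ for some $t$ with $\gcd(t,n)=1$. For integers $r,s\ge3$, $\Gamma(r,s)$ is the graph on $\mathbb Z_r\times\mathbb Z_s$ with $(i,j)$ adjacent to $(i\pm1,j\pm1)$, oriented by $(i,j)\to(i\pm1,j+1)$; $\mu:(i,j)\mapsto(i+1,j)$, $\nu:(i,j)\mapsto(i,j+1)$, $\sigma:(i,j)\mapsto(-i,j)$, and $G(r,s)=\langle\mu,\nu,\sigma\rangle$. If $r,s$ are both even, $\Gamma^+(r,s)$ is the subgraph induced on $X^+=\{(i,j): i,j\text{ of the same parity}\}$, with the restricted orientation, and $G^+(r,s)=\langle\mu^2,\mu\nu,\sigma\rangle$ acting on $X^+$. **Corollary.** Let $(\Gamma,G)\in\mathrm{OG}(4)$, let $\Gamma$ be a weak $(m,n)$-metacirculant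 relative to $(\rho,\lambda)$ with $\rho,\lambda\in G$, and put $R=\langle\rho\rangle$. Suppose that $\Gamma_R$ is a cyclic $G$-oriented normal quotient of $(\Gamma,G)$ (of length $m\ge3$), and that $(\Gamma,G)$ has independent cyclic normal quotients $\Gamma_N$, $\Gamma_M$ with $N,M$ normal in $G$. Then $(\Gamma,G)$ has independent cyclic normal quotients $\Gamma_{N'}\cong C_r$ and $\Gamma_{M'}\cong C_s$, with $\Gamma_{N'}$ not $G$-oriented and $\Gamma_{M'}$ $G$-oriented, which may be taken to be the given two, suitably ordered, whenever one of the given two is $G$-oriented, such that one of the following holds: 1. at least one of $r,s$ is odd, $(\Gamma(r,s),G(r,s))\in\mathrm{OG}(4)$, $(\Gamma,G)$ is a normal cover of $(\Gamma(r,s),G(r,s))$, and $\Gamma(r,s)$ is a weak $(s,r)$-metacirculant relative to $(\mu,\nu)$; 2. $r,s$ are both even, $(\Gamma^+(r,s),G^+(r,s))\in\mathrm{OG}(4)$, $(\Gamma,G)$ is a normal cover of $(\Gamma^+(r,s),G^+(r,s))$, and $\Gamma^+(r,s)$ is a weak $(s,r/2)$-metacirculant relative to $(\mu^2,\mu\nu)$.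 -/

import Mathlib

namespace OG4

universe u v

section Pairs

variable {V : Type u} {W : Type v}

/-- `(Γ, G) ∈ OG(4)` with specified `G`-orbit `Δ`: the graph `Γ` is finite, simple, connected and
4-valent, `G` is a vertex-transitive and edge-transitive group of automorphisms of `Γ`, and `Δ` is a
`G`-orbit on ordered pairs of vertices that consists of exactly one ordered pair for each edge. -/
structure IsOG4 (Γ : SimpleGraph V) (G : Subgroup (Equiv.Perm V)) (Δ : Set (V × V)) : Prop where
  finite : Finite V
  connected : Γ.Connected
  valency : ∀ x, (Γ.neighborSet x).ncard = 4
  automorphisms : ∀ g ∈ G, ∀ x y, Γ.Adj (g x) (g y) ↔ Γ.Adj x y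
  vertex_transitive : ∀ x y, ∃ g ∈ G, g x = y
  edge_transitive : ∀ e ∈ Γ.edgeSet, ∀ e' ∈ Γ.edgeSet, ∃ g ∈ G, Sym2.map g e = e'
  orbit : ∃ x y, Δ = {p : V × V | ∃ g ∈ G, p = (g x, g y)}
  adj_of_mem : ∀ x y, (x, y) ∈ Δ → Γ.Adj x y
  one_per_edge : ∀ x y, Γ.Adj x y → Xor ((x, y) ∈ Δ) ((y, x) ∈ Δ)

variable {G : Subgroup (Equiv.Perm V)}

/-- The set of `N`-orbits of vertices, for a subgroup `N` of the permutation group `G`. -/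
abbrev Orbits (N : Subgroup G) : Type u := MulAction.orbitRel.Quotient N V

/-- The `N`-orbit of the vertex `x`. -/
def orb (N : Subgroup G) (x : V) : Orbits N := Quotient.mk _ x

/-- The quotient graph `Γ_N`: its vertices are the `N`-orbits, two distinct orbits being adjacent
if and only if there is at least one edge of `Γ` between them. -/
def quotientGraph (Γ : SimpleGraph V) (N : Subgroup G) : SimpleGraph (Orbits N) where
  Adj B C := B ≠ C ∧ ∃ x y, orb N x = B ∧ orb N y = C ∧ Γ.Adj x y
  symm := ⟨fun _ _ ⟨h, x, y, hx, hy, hxy⟩ => ⟨h.symm, y, x, hy, hx, hxy.symm⟩⟩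
  loopless := ⟨fun _ h => h.1 rfl⟩

/-- `N` and `N'` have the same orbits on vertices. -/
def SameOrbits (N N' : Subgroup G) : Prop :=
  ∀ x y : V, orb N x = orb N y ↔ orb N' x = orb N' y

/-- `Γ_N` is a cycle `C_k` of length `k ≥ 3`. -/
def IsCycleQuotient (Γ : SimpleGraph V) (N : Subgroup G) (k : ℕ) : Prop :=
  3 ≤ k ∧ Nonempty (quotientGraph Γ N ≃g SimpleGraph.cycleGraph k)

/-- `Γ_N` inherits the edge-orientation `Δ`: for any two distinct `N`-orbits, all the edges between
them have the same orientation. -/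
def IsOrientedQuotient (Δ : Set (V × V)) (N : Subgroup G) : Prop :=
  ∀ x y x' y' : V, orb N x ≠ orb N y → orb N x' = orb N x → orb N y' = orb N y →
    (x, y) ∈ Δ → (y', x') ∉ Δ

/-- The subgroup of all elements of `G` that fix setwise each `N`-orbit. -/
def orbitKernel (N : Subgroup G) : Subgroup G where
  carrier := {g | ∀ x : V, orb N (g • x) = orb N x}
  one_mem' := fun x => by rw [one_smul]
  mul_mem' := fun {a b} ha hb x => by rw [mul_smul, ha, hb]
  inv_mem' := fun {a} ha x => by
    have h := ha (a⁻¹ • x)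
    rw [smul_inv_smul] at h
    exact h.symm

/-- The cyclic normal quotients `Γ_N`, `Γ_M` are independent: `Γ_K` is not a cycle, where `K` is the
intersection of the subgroups fixing setwise each `N`-orbit, respectively each `M`-orbit. -/
def AreIndependent (Γ : SimpleGraph V) (N M : Subgroup G) : Prop :=
  ¬ ∃ k, IsCycleQuotient Γ (orbitKernel N ⊓ orbitKernel M) k

/-- `(Γ, G)` is a normal cover of `(Γ', G')`: for some normal subgroup `T` of `G`, each vertex
of a `T`-orbit `B` is joined to exactly one vertex of each orbit `C` adjacent to `B` in `Γ_T`, and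
the graph-group pair `(Γ_T, G/T)` is isomorphic to `(Γ', G')`. -/
def IsNormalCover (Γ : SimpleGraph V) (G : Subgroup (Equiv.Perm V))
    (Γ' : SimpleGraph W) (G' : Subgroup (Equiv.Perm W)) : Prop :=
  ∃ (T : Subgroup G) (_ : T.Normal),
    (∀ (x : V) (C : Orbits T), (quotientGraph Γ T).Adj (orb T x) C →
      ∃! y, orb T y = C ∧ Γ.Adj x y) ∧
    ∃ (f : quotientGraph Γ T ≃g Γ') (φ : G ⧸ T ≃* G'),
      ∀ (g : G) (x : V), f (orb T (g • x)) = (φ (g : G ⧸ T) : Equiv.Perm W) (f (orb T x))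

/-- `Γ` is a weak `(m, n)`-metacirculant relative to `(ρ, lam)`. -/
structure IsWeakMetacirculant (Γ : SimpleGraph V) (m n : ℕ) (ρ lam : Equiv.Perm V) : Prop where
  finite : Finite V
  rho_aut : ∀ x y, Γ.Adj (ρ x) (ρ y) ↔ Γ.Adj x y
  lam_aut : ∀ x y, Γ.Adj (lam x) (lam y) ↔ Γ.Adj x y
  card_eq : Nat.card V = m * n
  card_cycles : Nat.card (Quotient (Equiv.Perm.SameCycle.setoid ρ)) = m
  cycle_length : ∀ x, {y | ρ.SameCycle x y}.ncard = n
  transitive_on_cycles : ∀ x y, ∃ k : ℤ, ρ.SameCycle ((lam ^ k) x) y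
  conj_eq : ∃ t : ℕ, t.Coprime n ∧ lam * ρ * lam⁻¹ = ρ ^ t

end Pairs

section Examples

variable (r s : ℕ)

/-- The graph `Γ(r,s)` on `ℤ_r × ℤ_s`: the vertex `(i,j)` is joined to the vertices
`(i ± 1, j ± 1)` (the inequality built into `fromRel` is automatic for `r, s ≥ 3`). -/
def gammaGraph : SimpleGraph (ZMod r × ZMod s) :=
  SimpleGraph.fromRel fun p q =>
    (q.1 = p.1 + 1 ∨ q.1 = p.1 - 1) ∧ (q.2 = p.2 + 1 ∨ q.2 = p.2 - 1)

/-- `μ : (i,j) ↦ (i+1,j)`. -/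
def mu : Equiv.Perm (ZMod r × ZMod s) where
  toFun p := (p.1 + 1, p.2)
  invFun p := (p.1 - 1, p.2)
  left_inv p := by simp
  right_inv p := by simp

/-- `ν : (i,j) ↦ (i,j+1)`. -/
def nu : Equiv.Perm (ZMod r × ZMod s) where
  toFun p := (p.1, p.2 + 1)
  invFun p := (p.1, p.2 - 1)
  left_inv p := by simp
  right_inv p := by simp

/-- `σ : (i,j) ↦ (-i,j)`. -/
def sigma : Equiv.Perm (ZMod r × ZMod s) where
  toFun p := (-p.1, p.2)
  invFun p := (-p.1, p.2)
  left_inv p := by simp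
  right_inv p := by simp

/-- `G(r,s) = ⟨μ, ν, σ⟩`. -/
def groupG : Subgroup (Equiv.Perm (ZMod r × ZMod s)) :=
  Subgroup.closure {mu r s, nu r s, sigma r s}

/-- The edge-orientation `(i,j) → (i ± 1, j + 1)`. -/
def arrows : Set ((ZMod r × ZMod s) × (ZMod r × ZMod s)) :=
  {e | (e.2.1 = e.1.1 + 1 ∨ e.2.1 = e.1.1 - 1) ∧ e.2.2 = e.1.2 + 1}

variable {r s}
variable (hr : Even r) (hs : Even s)

/-- For `r`, `s` even, the vertex `(i,j)` is in `X⁺` if `i` and `j` have the same parity; the parity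
of an element of `ℤ_k`, `k` even, is its image in `ℤ_2`. -/
def SameParity (p : ZMod r × ZMod s) : Prop :=
  ZMod.castHom hr.two_dvd (ZMod 2) p.1 = ZMod.castHom hs.two_dvd (ZMod 2) p.2

/-- The vertex set `X⁺`. -/
abbrev PlusVertex : Type := {p : ZMod r × ZMod s // SameParity hr hs p}

/-- `Γ⁺(r,s)`, the subgraph of `Γ(r,s)` induced on `X⁺`. -/
def gammaPlus : SimpleGraph (PlusVertex hr hs) :=
  (gammaGraph r s).induce {p | SameParity hr hs p}

theorem sameParity_muSq (p : ZMod r × ZMod s) :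
    SameParity hr hs ((mu r s ^ 2) p) ↔ SameParity hr hs p := by
  have h : (1 : ZMod 2) + 1 = 0 := by decide
  have e : (mu r s ^ 2) p = (p.1 + 1 + 1, p.2) := rfl
  rw [e, SameParity, SameParity, map_add, map_add, map_one, add_assoc, h, add_zero]

theorem sameParity_muNu (p : ZMod r × ZMod s) :
    SameParity hr hs ((mu r s * nu r s) p) ↔ SameParity hr hs p := by
  have e : (mu r s * nu r s) p = (p.1 + 1, p.2 + 1) := rfl
  rw [e, SameParity, SameParity, map_add, map_add, map_one, map_one, add_left_inj]

theorem sameParity_sigma (p : ZMod r × ZMod s) :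
    SameParity hr hs (sigma r s p) ↔ SameParity hr hs p := by
  have e : sigma r s p = (-p.1, p.2) := rfl
  rw [e, SameParity, SameParity, map_neg, ZMod.neg_eq_self_mod_two]

/-- The restriction of `μ²` to `X⁺`. -/
def muSqPlus : Equiv.Perm (PlusVertex hr hs) :=
  (mu r s ^ 2).subtypePerm (sameParity_muSq hr hs)

/-- The restriction of `μν` to `X⁺`. -/
def muNuPlus : Equiv.Perm (PlusVertex hr hs) :=
  (mu r s * nu r s).subtypePerm (sameParity_muNu hr hs)

/-- The restriction of `σ` to `X⁺`. -/
def sigmaPlus : Equiv.Perm (PlusVertex hr hs) :=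
  (sigma r s).subtypePerm (sameParity_sigma hr hs)

/-- `G⁺(r,s) = ⟨μ², μν, σ⟩`, acting on `X⁺`. -/
def groupGPlus : Subgroup (Equiv.Perm (PlusVertex hr hs)) :=
  Subgroup.closure {muSqPlus hr hs, muNuPlus hr hs, sigmaPlus hr hs}

/-- The restriction to `X⁺` of the edge-orientation `(i,j) → (i ± 1, j + 1)`. -/
def arrowsPlus : Set (PlusVertex hr hs × PlusVertex hr hs) :=
  {e | (e.1.1, e.2.1) ∈ arrows r s}

end Examples

end OG4

open OG4

namespace OG4

universe u v

/-! ### Adjacency-preserving injections of the cycle on `ZMod k`. -/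

section CyclicGroup

variable {k : ℕ}

/-! An unoriented cyclic quotient `C_r` and an oriented one `C_s` together give coordinates on `Γ`.
Labelling the orbits by `ZMod r` and `ZMod s` yields a map `F` to the grid along which every arc
goes from `(i, j)` to `(i ± 1, j + 1)` (`exists_gridLabelling`). Since the first quotient is
unoriented, each vertex stabiliser contains an element reflecting the first coordinate
(`exists_reflection`); it fixes the second, because an oriented cycle admits only rotations. Hence
both signs occur among the out-neighbours and among the in-neighbours of a vertex, and its four
neighbours map bijectively onto the four grid neighbours (`injOn_neighborSet`).

So `F` is a covering of its image: the whole grid if `r` or `s` is odd, and `X⁺` if both are even.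
The group acts on labels by translations and first-coordinate reflections, which matches it with
`G(r,s)` or `G⁺(r,s)` (`isEquivariantCovering`). The fibres of `F` are the orbits of the
intersection `K` of the two orbit kernels, so `Γ_K` is the 4-valent base graph. This gives the
normal cover, and also independence.

It remains to find one quotient of each kind. Two oriented quotients are never independent: their
labels advance together, and `Γ_K` is a cycle of length `lcm(r, s)`
(`not_areIndependent_of_oriented`). So at most one of the given quotients is oriented. If neither
is, the oriented quotient by `⟨ρ⟩` takes the place of one of them, and the covering argument
supplies independence. -/

theorem two_ne_zero_of_three_le (hk : 3 ≤ k) : (2 : ZMod k) ≠ 0 := by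
  intro h
  have h' : ((2 : ℕ) : ZMod k) = 0 := by exact_mod_cast h
  rw [ZMod.natCast_eq_zero_iff] at h'
  exact absurd (Nat.le_of_dvd (by norm_num) h') (by omega)

theorem one_ne_zero_of_three_le (hk : 3 ≤ k) : (1 : ZMod k) ≠ 0 := fun h =>
  two_ne_zero_of_three_le hk (by linear_combination 2 * h)

/-- An injective self-map of the cycle `ℤ_k` that preserves adjacency is a rotation or a
reflection. -/
theorem cycle_endomorphism (hk : 3 ≤ k) (f : ZMod k → ZMod k) (hf : Function.Injective f)
    (hadj : ∀ i, f (i + 1) = f i + 1 ∨ f (i + 1) = f i - 1) :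
    ∃ ε b : ZMod k, (ε = 1 ∨ ε = -1) ∧ ∀ i, f i = ε * i + b := by
  have : NeZero k := ⟨by omega⟩
  -- Two successive steps of opposite sign would give `f (i + 2) = f i`, against injectivity; so all
  -- steps agree.
  have step : ∀ i, f (i + 1 + 1) - f (i + 1) = f (i + 1) - f i := by
    intro i
    have hne : f (i + 1 + 1) ≠ f i := fun h => two_ne_zero_of_three_le hk (by
      have := hf h
      linear_combination this)
    rcases hadj i with h | h <;> rcases hadj (i + 1) with h' | h'
    · rw [h', h]; ring
    · exact absurd (by rw [h', h]; ring) hne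
    · exact absurd (by rw [h', h]; ring) hne
    · rw [h', h]; ring
  have key : ∀ n : ℕ, f (n + 1) - f n = f 1 - f 0 := by
    intro n
    induction n with
    | zero => simp
    | succ n ih => push_cast; rw [step, ih]
  have all : ∀ n : ℕ, f n = (f 1 - f 0) * n + f 0 := by
    intro n
    induction n with
    | zero => simp
    | succ n ih => push_cast; linear_combination key n + ih
  refine ⟨f 1 - f 0, f 0, ?_, fun i => ?_⟩
  · have := hadj 0
    rw [zero_add] at this
    rcases this with h | h <;> rw [h] <;> simp
  · have := all i.val
    rwa [ZMod.natCast_zmod_val] at this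

end CyclicGroup

/-! ### Labellings of cyclic quotients, and how the orientation and the group act on them. -/

section Orientation

variable {V : Type u} {Γ : SimpleGraph V} {G : Subgroup (Equiv.Perm V)} {Δ : Set (V × V)}

namespace IsOG4

theorem arc_smul (h : IsOG4 Γ G Δ) (g : G) {x y : V} (hxy : (x, y) ∈ Δ) : (g • x, g • y) ∈ Δ := by
  obtain ⟨a, b, hΔ⟩ := h.orbit
  rw [hΔ] at hxy ⊢
  obtain ⟨g', hg', he⟩ := hxy
  obtain ⟨rfl, rfl⟩ := Prod.mk.inj he
  exact ⟨g * g', G.mul_mem g.2 hg', rfl⟩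

theorem exists_smul_arc (h : IsOG4 Γ G Δ) {x y x' y' : V} (hxy : (x, y) ∈ Δ)
    (hxy' : (x', y') ∈ Δ) : ∃ g : G, g • x = x' ∧ g • y = y' := by
  obtain ⟨a, b, hΔ⟩ := h.orbit
  rw [hΔ] at hxy hxy'
  obtain ⟨g, hg, he⟩ := hxy
  obtain ⟨g', hg', he'⟩ := hxy'
  obtain ⟨rfl, rfl⟩ := Prod.mk.inj he
  obtain ⟨rfl, rfl⟩ := Prod.mk.inj he'
  refine ⟨⟨g', hg'⟩ * ⟨g, hg⟩⁻¹, ?_, ?_⟩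
  · change g' (g⁻¹ (g a)) = g' a
    simp
  · change g' (g⁻¹ (g b)) = g' b
    simp

theorem exists_smul_eq (h : IsOG4 Γ G Δ) (x y : V) : ∃ g : G, g • x = y := by
  obtain ⟨g, hg, he⟩ := h.vertex_transitive x y
  exact ⟨⟨g, hg⟩, he⟩

theorem exists_out (h : IsOG4 Γ G Δ) (x : V) : ∃ y, (x, y) ∈ Δ := by
  obtain ⟨a, b, hΔ⟩ := h.orbit
  obtain ⟨g, hg, rfl⟩ := h.vertex_transitive a x
  exact ⟨g b, by rw [hΔ]; exact ⟨g, hg, rfl⟩⟩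

theorem exists_in (h : IsOG4 Γ G Δ) (x : V) : ∃ y, (y, x) ∈ Δ := by
  obtain ⟨a, b, hΔ⟩ := h.orbit
  obtain ⟨g, hg, rfl⟩ := h.vertex_transitive b x
  exact ⟨g a, by rw [hΔ]; exact ⟨g, hg, rfl⟩⟩

theorem arc_or_arc (h : IsOG4 Γ G Δ) {x y : V} (hxy : Γ.Adj x y) : (x, y) ∈ Δ ∨ (y, x) ∈ Δ :=
  (h.one_per_edge x y hxy).elim (fun h => Or.inl h.1) (fun h => Or.inr h.1)

theorem smul_adj (h : IsOG4 Γ G Δ) (g : G) {x y : V} : Γ.Adj (g • x) (g • y) ↔ Γ.Adj x y :=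
  h.automorphisms g g.2 x y

/-- A property that passes along the arcs in both directions and holds at one vertex holds
everywhere. -/
theorem arc_induction (h : IsOG4 Γ G Δ) {P : V → Prop} {x₀ : V} (h₀ : P x₀)
    (hout : ∀ x y, (x, y) ∈ Δ → P x → P y) (hin : ∀ x y, (x, y) ∈ Δ → P y → P x) (x : V) :
    P x := by
  obtain ⟨w⟩ := h.connected.preconnected x₀ x
  induction w with
  | nil => exact h₀
  | cons hadj _ ih =>
    refine ih ?_
    rcases h.arc_or_arc hadj with h' | h'
    · exact hout _ _ h' h₀
    · exact hin _ _ h' h₀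

end IsOG4

theorem orb_eq_iff {N : Subgroup G} {x y : V} : orb N x = orb N y ↔ ∃ g ∈ N, g • y = x := by
  unfold orb
  rw [Quotient.eq, MulAction.orbitRel_apply, MulAction.mem_orbit_iff]
  exact ⟨fun ⟨g, hg⟩ => ⟨g, g.2, hg⟩, fun ⟨g, hg, he⟩ => ⟨⟨g, hg⟩, he⟩⟩

theorem orb_smul_eq {N : Subgroup G} (hN : N.Normal) (g : G) {x y : V} (h : orb N x = orb N y) :
    orb N (g • x) = orb N (g • y) := by
  obtain ⟨n, hn, rfl⟩ := orb_eq_iff.1 h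
  refine orb_eq_iff.2 ⟨g * n * g⁻¹, hN.conj_mem n hn g, ?_⟩
  simp [mul_smul]

theorem orb_smul_eq_iff {N : Subgroup G} (hN : N.Normal) (g : G) {x y : V} :
    orb N (g • x) = orb N (g • y) ↔ orb N x = orb N y :=
  ⟨fun h => by simpa using orb_smul_eq hN g⁻¹ h, orb_smul_eq hN g⟩

/-- `c` labels the `N`-orbits by `ℤ_k` so that adjacent vertices have consecutive labels and the
group acts on labels by rotations and reflections. -/
structure IsCycleLabelling (Γ : SimpleGraph V) (N : Subgroup G) {k : ℕ} (c : V → ZMod k) :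
    Prop where
  surjective : Function.Surjective c
  eq_iff : ∀ x y, c x = c y ↔ orb N x = orb N y
  adj : ∀ x y, Γ.Adj x y → c y = c x + 1 ∨ c y = c x - 1
  act : ∀ g : G, ∃ ε b : ZMod k, (ε = 1 ∨ ε = -1) ∧ ∀ x, c (g • x) = ε * c x + b

/-- By normality each group element permutes the orbits, hence induces an injective
adjacency-preserving map of the cycle, to which `cycle_endomorphism` applies. -/
theorem exists_cycleLabelling (h : IsOG4 Γ G Δ) {N : Subgroup G} (hN : N.Normal) {k : ℕ}
    (hk : IsCycleQuotient Γ N k) : ∃ c : V → ZMod k, IsCycleLabelling Γ N c := by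
  obtain ⟨hk3, ⟨e⟩⟩ := hk
  -- In this form `ZMod k` unfolds to the `Fin` type on which `cycleGraph` is defined.
  obtain ⟨n, rfl⟩ : ∃ n, k = n + 1 + 2 := ⟨k - 3, by omega⟩
  let c : V → ZMod (n + 1 + 2) := fun x => e (orb N x)
  have hsurj : Function.Surjective c := by
    intro i
    obtain ⟨B, hB⟩ := e.surjective i
    obtain ⟨x, rfl⟩ := Quotient.exists_rep B
    exact ⟨x, hB⟩
  have heq : ∀ x y, c x = c y ↔ orb N x = orb N y := fun x y => e.injective.eq_iff
  have hcadj : ∀ x y, (quotientGraph Γ N).Adj (orb N x) (orb N y) ↔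
      c x - c y = 1 ∨ c y - c x = 1 := by
    intro x y
    rw [← e.map_adj_iff, SimpleGraph.cycleGraph_adj]
    rfl
  have hnext : ∀ i : ZMod (n + 1 + 2), ∃ x y, c x = i ∧ c y = i + 1 ∧ Γ.Adj x y := by
    intro i
    obtain ⟨x, rfl⟩ := hsurj i
    obtain ⟨y, hy⟩ := hsurj (c x + 1)
    obtain ⟨-, x', y', hx', hy', hadj⟩ := (hcadj x y).2 (Or.inr (by rw [hy]; ring))
    exact ⟨x', y', (heq _ _).2 hx', by rw [(heq _ _).2 hy', hy], hadj⟩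
  -- Some edge joins distinct orbits, so by edge-transitivity and normality no edge lies inside an
  -- orbit.
  have hne : ∀ x y, Γ.Adj x y → orb N x ≠ orb N y := by
    intro x y hxy hxy'
    obtain ⟨x', y', hx', hy', hadj⟩ := hnext 0
    have hne' : orb N x' ≠ orb N y' := by
      rw [Ne, ← heq, hx', hy', zero_add]
      exact (one_ne_zero_of_three_le hk3).symm
    obtain ⟨g, hg, he⟩ := h.edge_transitive s(x, y) hxy s(x', y') hadj
    rw [Sym2.map_mk, Sym2.eq_iff] at he
    have := orb_smul_eq hN ⟨g, hg⟩ hxy'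
    change orb N (g x) = orb N (g y) at this
    rcases he with ⟨h1, h2⟩ | ⟨h1, h2⟩ <;> rw [h1, h2] at this
    · exact hne' this
    · exact hne' this.symm
  have hadj : ∀ x y, Γ.Adj x y → c y = c x + 1 ∨ c y = c x - 1 := by
    intro x y hxy
    rcases (hcadj x y).1 ⟨hne x y hxy, x, y, rfl, rfl, hxy⟩ with h' | h'
    · right; linear_combination -h'
    · left; linear_combination h'
  refine ⟨c, hsurj, heq, hadj, fun g => ?_⟩
  have hinv : ∀ x, c (g • Function.surjInv hsurj (c x)) = c (g • x) := fun x =>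
    (heq _ _).2 (orb_smul_eq hN g ((heq _ _).1 (Function.surjInv_eq hsurj _)))
  obtain ⟨ε, b, hε, hf⟩ := cycle_endomorphism hk3
    (fun i => c (g • Function.surjInv hsurj i)) (fun i j hij => by
      have := (heq _ _).2 ((orb_smul_eq_iff hN g).1 ((heq _ _).1 hij))
      rwa [Function.surjInv_eq hsurj, Function.surjInv_eq hsurj] at this) (fun i => by
      obtain ⟨x, y, rfl, hy, hxy⟩ := hnext i
      rw [← hy, hinv, hinv]
      exact hadj _ _ ((h.smul_adj g).2 hxy))
  exact ⟨ε, b, hε, fun x => by rw [← hf, hinv]⟩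

variable {N : Subgroup G} {k : ℕ} {c : V → ZMod k}

theorem IsCycleLabelling.mul_add (hc : IsCycleLabelling Γ N c) {ε : ZMod k}
    (hε : ε = 1 ∨ ε = -1) (b : ZMod k) : IsCycleLabelling Γ N (fun x => ε * c x + b) := by
  have hεε : ε * ε = 1 := by rcases hε with rfl | rfl <;> ring
  refine ⟨fun i => ?_, fun x y => ?_, fun x y hxy => ?_, fun g => ?_⟩
  · obtain ⟨x, hx⟩ := hc.surjective (ε * (i - b))
    exact ⟨x, by rw [hx]; linear_combination (i - b) * hεε⟩
  · rw [← hc.eq_iff]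
    exact ⟨fun h => by linear_combination ε * h - (c x - c y) * hεε, fun h => by rw [h]⟩
  · rcases hc.adj x y hxy with h | h <;> rcases hε with rfl | rfl <;> rw [h]
    · left; ring
    · right; ring
    · right; ring
    · left; ring
  · obtain ⟨δ, t, hδ, h⟩ := hc.act g
    exact ⟨δ, ε * t + b - δ * b, hδ, fun x => by rw [h]; ring⟩

/-- If the labels change by the same amount along consecutive arcs, they change by the same amount
along all arcs. -/
theorem constant_of_consecutive (h : IsOG4 Γ G Δ) {A : Type*} [AddCommGroup A] {c : V → A}
    (hc : ∀ x y z, (x, y) ∈ Δ → (y, z) ∈ Δ → c z - c y = c y - c x) {x₀ y₀ : V}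
    (h₀ : (x₀, y₀) ∈ Δ) {x y : V} (hxy : (x, y) ∈ Δ) : c y - c x = c y₀ - c x₀ := by
  refine h.arc_induction (P := fun x => ∀ y, (x, y) ∈ Δ → c y - c x = c y₀ - c x₀) (x₀ := x₀)
    ?_ ?_ ?_ x y hxy
  · intro y hy
    obtain ⟨w, hw⟩ := h.exists_in x₀
    rw [hc w x₀ y hw hy, hc w x₀ y₀ hw h₀]
  · intro x y hxy hx z hyz
    rw [hc x y z hxy hyz, hx y hxy]
  · intro x y hxy hy z hxz
    -- All arcs leaving `x` have the step of a common arc `w → x`; the arc `x → y` among them has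
    -- the step of `y → u`, which is known.
    obtain ⟨w, hw⟩ := h.exists_in x
    obtain ⟨u, hu⟩ := h.exists_out y
    rw [hc w x z hw hxz, ← hc w x y hw hxy, ← hc x y u hxy hu, hy u hu]

theorem IsCycleLabelling.arc (hc : IsCycleLabelling Γ N c) (h : IsOG4 Γ G Δ) {x y : V}
    (hxy : (x, y) ∈ Δ) : c y = c x + 1 ∨ c y = c x - 1 := hc.adj x y (h.adj_of_mem x y hxy)

/-- Orientedness forbids a directed path from returning to the label it left two arcs before, so
consecutive steps agree and the step is a constant `±1`. Multiplying the labels by it makes the step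
`1`. -/
theorem IsCycleLabelling.exists_forward (hc : IsCycleLabelling Γ N c) (h : IsOG4 Γ G Δ)
    (hk : 3 ≤ k) (ho : IsOrientedQuotient Δ N) :
    ∃ c' : V → ZMod k, IsCycleLabelling Γ N c' ∧ ∀ x y, (x, y) ∈ Δ → c' y = c' x + 1 := by
  have hcons : ∀ x y z, (x, y) ∈ Δ → (y, z) ∈ Δ → c z - c y = c y - c x := by
    intro x y z hxy hyz
    have hne : orb N x ≠ orb N y := by
      rw [Ne, ← hc.eq_iff]
      intro he
      apply one_ne_zero_of_three_le hk
      rcases hc.arc h hxy with h' | h'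
      · linear_combination -h' - he
      · linear_combination h' + he
    have hzx : c z ≠ c x := fun he => ho x y z y hne ((hc.eq_iff _ _).1 he) rfl hxy hyz
    rcases hc.arc h hxy with h1 | h1 <;> rcases hc.arc h hyz with h2 | h2
    · rw [h2, h1]; ring
    · exact absurd (by rw [h2, h1]; ring) hzx
    · exact absurd (by rw [h2, h1]; ring) hzx
    · rw [h2, h1]; ring
  obtain ⟨x₀, -⟩ := hc.surjective 0
  obtain ⟨y₀, h₀⟩ := h.exists_out x₀
  have hd : c y₀ - c x₀ = 1 ∨ c y₀ - c x₀ = -1 := by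
    rcases hc.arc h h₀ with h' | h' <;> rw [h'] <;> simp
  refine ⟨_, hc.mul_add hd 0, fun x y hxy => ?_⟩
  have hdd : (c y₀ - c x₀) * (c y₀ - c x₀) = 1 := by rcases hd with h' | h' <;> rw [h'] <;> ring
  linear_combination hdd + (c y₀ - c x₀) * constant_of_consecutive h hcons h₀ hxy

/-- Comparing the labels along an arc and along its image excludes reflections. -/
theorem IsCycleLabelling.act_of_forward (hc : IsCycleLabelling Γ N c) (h : IsOG4 Γ G Δ)
    (hf : ∀ x y, (x, y) ∈ Δ → c y = c x + 1) (g : G) : ∃ b, ∀ x, c (g • x) = c x + b := by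
  obtain ⟨ε, b, -, hg⟩ := hc.act g
  obtain ⟨x, -⟩ := hc.surjective 0
  obtain ⟨y, hxy⟩ := h.exists_out x
  have h1 := hf _ _ (h.arc_smul g hxy)
  have hε : ε = 1 := by
    rw [hg, hg, hf _ _ hxy] at h1
    linear_combination h1
  exact ⟨b, fun z => by rw [hg, hε, one_mul]⟩

theorem IsCycleLabelling.oriented_of_constant (hc : IsCycleLabelling Γ N c) (h : IsOG4 Γ G Δ)
    (hk : 3 ≤ k) (d : ZMod k) (hd : ∀ x y, (x, y) ∈ Δ → c y - c x = d) :
    IsOrientedQuotient Δ N := by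
  intro x y x' y' _ hx hy hxy hyx
  have hx' := (hc.eq_iff _ _).2 hx
  have hy' := (hc.eq_iff _ _).2 hy
  have h1 := hd _ _ hxy
  have h2 := hd _ _ hyx
  apply two_ne_zero_of_three_le hk
  rcases hc.arc h hxy with h' | h'
  · linear_combination -2 * h' + h1 - h2 + hx' - hy'
  · linear_combination 2 * h' - hx' + hy' - h1 + h2

/-- In an unoriented cyclic quotient every vertex stabiliser contains an element inducing the
reflection of the cycle. -/
theorem IsCycleLabelling.exists_reflection (hc : IsCycleLabelling Γ N c) (h : IsOG4 Γ G Δ)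
    (hk : 3 ≤ k) (ho : ¬ IsOrientedQuotient Δ N) (x : V) :
    ∃ g : G, g • x = x ∧ ∀ y, c (g • y) = 2 * c x - c y := by
  have hconj : ∀ x x' : V, (∃ g : G, g • x = x ∧ ∀ y, c (g • y) = 2 * c x - c y) →
      ∃ g : G, g • x' = x' ∧ ∀ y, c (g • y) = 2 * c x' - c y := by
    rintro x x' ⟨g, hgx, hg⟩
    obtain ⟨t, rfl⟩ := h.exists_smul_eq x x'
    refine ⟨t * g * t⁻¹, by simp [mul_smul, hgx], fun y => ?_⟩
    obtain ⟨ε, b, hε, ht⟩ := hc.act t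
    have hy : c y = ε * c (t⁻¹ • y) + b := by rw [← ht, smul_inv_smul]
    rw [mul_smul, mul_smul, ht, hg, ht, hy]
    ring
  -- Without a reflection, every vertex stabiliser fixes all labels. The out-neighbours of a vertex
  -- then share one label, so up to a factor all directed 2-paths have the label pattern of `w → x →
  -- y`.
  by_contra hno
  have hstab : ∀ (x : V) (g : G), g • x = x → ∀ y, c (g • y) = c y := by
    intro x' g hg y
    obtain ⟨ε, b, hε, hgc⟩ := hc.act g
    have hx' := hgc x'
    rw [hg] at hx'
    rcases hε with rfl | rfl
    · rw [hgc]; linear_combination -hx'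
    · exact absurd (hconj x' x ⟨g, hg, fun y => by rw [hgc]; linear_combination -hx'⟩) hno
  have hout : ∀ x y y', (x, y) ∈ Δ → (x, y') ∈ Δ → c y = c y' := by
    intro x y y' hy hy'
    obtain ⟨g, hg, rfl⟩ := h.exists_smul_arc hy hy'
    exact (hstab x g hg y).symm
  obtain ⟨y, hxy⟩ := h.exists_out x
  obtain ⟨w, hwx⟩ := h.exists_in x
  have htrans : ∀ x' y' w', (x', y') ∈ Δ → (w', x') ∈ Δ →
      ∃ ε : ZMod k, c y' - c x' = ε * (c y - c x) ∧ c x' - c w' = ε * (c x - c w) := by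
    intro x' y' w' hx' hw'
    obtain ⟨g, rfl, rfl⟩ := h.exists_smul_arc hwx hw'
    obtain ⟨ε, b, -, hg⟩ := hc.act g
    refine ⟨ε, ?_, ?_⟩
    · rw [hout _ _ _ hx' (h.arc_smul g hxy), hg, hg]; ring
    · rw [hg, hg]; ring
  -- Equal steps propagate to a constant step, contradicting unorientedness. Otherwise every
  -- directed 2-path returns to its initial label, so only two labels occur, too few for `k ≥ 3`.
  by_cases hd : c y - c x = c x - c w
  · refine ho (hc.oriented_of_constant h hk (c y - c x) fun x' y' h' => ?_)
    refine constant_of_consecutive h (fun a b e hab hbe => ?_) hxy h'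
    obtain ⟨ε, h1, h2⟩ := htrans b e a hbe hab
    rw [h1, h2, hd]
  · have hd' : c y = c w := by
      rcases hc.arc h hxy with h1 | h1 <;> rcases hc.arc h hwx with h2 | h2
      · exact absurd (by rw [h1, h2]; ring) hd
      · rw [h1, h2]; ring
      · rw [h1, h2]; ring
      · exact absurd (by rw [h1, h2]; ring) hd
    have hback : ∀ a b e, (a, b) ∈ Δ → (b, e) ∈ Δ → c e = c a := by
      intro a b e hab hbe
      obtain ⟨ε, h1, h2⟩ := htrans b e a hbe hab
      linear_combination h1 + h2 + ε * hd'
    have htwo : ∀ v, (c v = c x ∧ ∀ u, (v, u) ∈ Δ → c u = c y) ∨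
        (c v = c y ∧ ∀ u, (v, u) ∈ Δ → c u = c x) := by
      refine h.arc_induction (x₀ := x) (Or.inl ⟨rfl, fun u hu => hout _ _ _ hu hxy⟩) ?_ ?_
      · rintro v u hvu (⟨h1, h2⟩ | ⟨h1, h2⟩)
        · exact Or.inr ⟨h2 u hvu, fun t ht => by rw [hback v u t hvu ht, h1]⟩
        · exact Or.inl ⟨h2 u hvu, fun t ht => by rw [hback v u t hvu ht, h1]⟩
      · rintro v u hvu hu
        obtain ⟨t, ht⟩ := h.exists_out u
        have hvt := hback v u t hvu ht
        rcases hu with ⟨h1, h2⟩ | ⟨h1, h2⟩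
        · exact Or.inr ⟨by rw [← hvt, h2 t ht], fun s hs => by rw [hout v s u hs hvu, h1]⟩
        · exact Or.inl ⟨by rw [← hvt, h2 t ht], fun s hs => by rw [hout v s u hs hvu, h1]⟩
    have hval : ∀ i, i = c x ∨ i = c y := by
      intro i
      obtain ⟨v, rfl⟩ := hc.surjective i
      exact (htwo v).imp And.left And.left
    have e1 : c x + 1 = c y := (hval _).resolve_left fun e =>
      one_ne_zero_of_three_le hk (by linear_combination e)
    have e2 : c x - 1 = c y := (hval _).resolve_left fun e =>
      one_ne_zero_of_three_le hk (by linear_combination -e)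
    exact two_ne_zero_of_three_le hk (by linear_combination e1 - e2)

/-- A labelling of the `K`-orbits by `ℤ_k` that increases by one along every arc exhibits `Γ_K` as
a cycle. -/
theorem isCycleQuotient_of_forward (h : IsOG4 Γ G Δ) {K : Subgroup G} (hk : 3 ≤ k)
    (hsurj : Function.Surjective c) (heq : ∀ x y, c x = c y ↔ orb K x = orb K y)
    (hf : ∀ x y, (x, y) ∈ Δ → c y = c x + 1) : IsCycleQuotient Γ K k := by
  refine ⟨hk, ?_⟩
  obtain ⟨n, rfl⟩ : ∃ n, k = n + 1 + 2 := ⟨k - 3, by omega⟩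
  let f : Orbits K → ZMod (n + 1 + 2) := Quotient.lift c fun x y hxy =>
    (heq x y).2 (Quotient.sound hxy)
  have hbij : Function.Bijective f := by
    refine ⟨fun B C hBC => ?_, fun i => ?_⟩
    · induction B using Quotient.inductionOn with | _ x =>
      induction C using Quotient.inductionOn with | _ y =>
      exact (heq x y).1 hBC
    · obtain ⟨x, rfl⟩ := hsurj i
      exact ⟨orb K x, rfl⟩
  have harc : ∀ x y, c y = c x + 1 → ∃ z, orb K z = orb K y ∧ Γ.Adj x z := by
    intro x y hxy
    obtain ⟨z, hz⟩ := h.exists_out x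
    exact ⟨z, (heq _ _).1 (by rw [hf _ _ hz, hxy]), h.adj_of_mem _ _ hz⟩
  refine ⟨⟨Equiv.ofBijective f hbij, ?_⟩⟩
  intro B C
  induction B using Quotient.inductionOn with | _ x =>
  induction C using Quotient.inductionOn with | _ y =>
  change (c x - c y = 1 ∨ c y - c x = 1) ↔ (quotientGraph Γ K).Adj (orb K x) (orb K y)
  constructor
  · intro hxy
    have hne : orb K x ≠ orb K y := by
      rw [Ne, ← heq]
      intro he
      rw [he, sub_self, or_self] at hxy
      exact one_ne_zero_of_three_le hk hxy.symm
    rcases hxy with hxy | hxy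
    · obtain ⟨z, hz, hyz⟩ := harc y x (by linear_combination hxy)
      exact ⟨hne, z, y, hz, rfl, hyz.symm⟩
    · obtain ⟨z, hz, hyz⟩ := harc x y (by linear_combination hxy)
      exact ⟨hne, x, z, rfl, hz, hyz⟩
  · rintro ⟨-, x', y', hx', hy', hadj⟩
    rw [← (heq _ _).2 hx', ← (heq _ _).2 hy']
    rcases h.arc_or_arc hadj with h' | h' <;> rw [hf _ _ h']
    · right; ring
    · left; ring

end Orientation

end OG4

namespace OG4

universe u v

/-! ### Two oriented cyclic quotients have a common cyclic refinement. -/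

section Independence

variable {V : Type u} {Γ : SimpleGraph V} {G : Subgroup (Equiv.Perm V)} {Δ : Set (V × V)}
  {N M : Subgroup G} {r s : ℕ} {a : V → ZMod r} {b : V → ZMod s}

theorem mem_orbitKernel_inf_iff (ha : IsCycleLabelling Γ N a) (hb : IsCycleLabelling Γ M b)
    (g : G) : g ∈ orbitKernel N ⊓ orbitKernel M ↔
      ∀ x, a (g • x) = a x ∧ b (g • x) = b x := by
  simp only [ha.eq_iff, hb.eq_iff]
  exact ⟨fun h x => ⟨h.1 x, h.2 x⟩, fun h => ⟨fun x => (h x).1, fun x => (h x).2⟩⟩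

/-- Two `G`-oriented cyclic normal quotients are never independent. -/
theorem not_areIndependent_of_oriented (h : IsOG4 Γ G Δ) (hN : N.Normal) (hM : M.Normal)
    (hNr : IsCycleQuotient Γ N r) (hMs : IsCycleQuotient Γ M s) (hNo : IsOrientedQuotient Δ N)
    (hMo : IsOrientedQuotient Δ M) : ¬ AreIndependent Γ N M := by
  obtain ⟨a₀, ha₀⟩ := exists_cycleLabelling h hN hNr
  obtain ⟨b₀, hb₀⟩ := exists_cycleLabelling h hM hMs
  obtain ⟨a₁, ha₁, ha₁f⟩ := ha₀.exists_forward h hNr.1 hNo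
  obtain ⟨b₁, hb₁, hb₁f⟩ := hb₀.exists_forward h hMs.1 hMo
  obtain ⟨x₀, -⟩ := ha₀.surjective 0
  have haf : ∀ x y, (x, y) ∈ Δ → a₁ y - a₁ x₀ = a₁ x - a₁ x₀ + 1 := fun x y hxy => by
    rw [ha₁f x y hxy]; ring
  have hbf : ∀ x y, (x, y) ∈ Δ → b₁ y - b₁ x₀ = b₁ x - b₁ x₀ + 1 := fun x y hxy => by
    rw [hb₁f x y hxy]; ring
  -- Both labels, normalised at `x₀`, change by one along each arc, so a single integer represents
  -- both. Only its class modulo `lcm(r, s)` is determined by the labels.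
  have hdiag : ∀ x, ∃ n : ℤ, a₁ x - a₁ x₀ = n ∧ b₁ x - b₁ x₀ = n := by
    refine h.arc_induction (x₀ := x₀) ⟨0, by simp⟩ ?_ ?_
    · rintro x y hxy ⟨n, h1, h2⟩
      exact ⟨n + 1, by rw [haf x y hxy, h1]; push_cast; rfl,
        by rw [hbf x y hxy, h2]; push_cast; rfl⟩
    · rintro x y hxy ⟨n, h1, h2⟩
      exact ⟨n - 1, by push_cast; rw [← h1, haf x y hxy]; ring,
        by push_cast; rw [← h2, hbf x y hxy]; ring⟩
  choose n hna hnb using hdiag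
  have hlcm : ∀ i j : ℤ, (i : ZMod (r.lcm s)) = j ↔ (i : ZMod r) = j ∧ (i : ZMod s) = j := by
    intro i j
    simp only [ZMod.intCast_eq_intCast_iff_dvd_sub]
    exact (Int.coe_lcm_dvd_iff : ((Int.lcm r s : ℕ) : ℤ) ∣ j - i ↔ _)
  have heq : ∀ x y, ((n x : ℤ) : ZMod (r.lcm s)) = (n y : ℤ) ↔ a₁ x = a₁ y ∧ b₁ x = b₁ y := by
    intro x y
    rw [hlcm, ← hna, ← hna, ← hnb, ← hnb, sub_left_inj, sub_left_inj]
  have hfwd : ∀ x y, (x, y) ∈ Δ → ((n y : ℤ) : ZMod (r.lcm s)) = (n x : ℤ) + 1 := by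
    intro x y hxy
    have : ((n y : ℤ) : ZMod (r.lcm s)) = ((n x + 1 : ℤ) : ZMod (r.lcm s)) := by
      rw [hlcm]
      push_cast
      rw [← hna, ← hna, ← hnb, ← hnb]
      exact ⟨haf x y hxy, hbf x y hxy⟩
    rw [this]; push_cast; rfl
  have hpos : 0 < r.lcm s := Nat.lcm_pos (by have := hNr.1; omega) (by have := hMs.1; omega)
  have : NeZero (r.lcm s) := ⟨hpos.ne'⟩
  intro hind
  refine hind ⟨r.lcm s, isCycleQuotient_of_forward h (c := fun x => ((n x : ℤ) : ZMod (r.lcm s)))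
    (hNr.1.trans (Nat.le_of_dvd hpos (Nat.dvd_lcm_left r s))) ?_ ?_ hfwd⟩
  · have hall : ∀ m : ℕ, ∃ x, ((n x : ℤ) : ZMod (r.lcm s)) = ((n x₀ : ℤ) : ZMod (r.lcm s)) + m := by
      intro m
      induction m with
      | zero => exact ⟨x₀, by simp⟩
      | succ m ih =>
        obtain ⟨x, hx⟩ := ih
        obtain ⟨y, hxy⟩ := h.exists_out x
        exact ⟨y, by rw [hfwd x y hxy, hx]; push_cast; ring⟩
    intro i
    obtain ⟨x, hx⟩ := hall (i - ((n x₀ : ℤ) : ZMod (r.lcm s))).val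
    exact ⟨x, by dsimp only; rw [hx, ZMod.natCast_zmod_val]; ring⟩
  · intro x y
    rw [heq, orb_eq_iff]
    constructor
    · rintro ⟨h1, h2⟩
      -- Any `g` taking `y` to `x` translates both labels. Both translations vanish at `y`, hence
      -- everywhere, so `g` lies in the intersection of the kernels.
      obtain ⟨g, rfl⟩ := h.exists_smul_eq y x
      refine ⟨g, (mem_orbitKernel_inf_iff ha₁ hb₁ g).2 fun z => ?_, rfl⟩
      obtain ⟨t, ht⟩ := ha₁.act_of_forward h ha₁f g
      obtain ⟨u, hu⟩ := hb₁.act_of_forward h hb₁f g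
      rw [ht] at h1
      rw [hu] at h2
      rw [ht, hu, left_eq_add.1 h1.symm, left_eq_add.1 h2.symm, add_zero, add_zero]
      exact ⟨rfl, rfl⟩
    · rintro ⟨g, hg, rfl⟩
      exact (mem_orbitKernel_inf_iff ha₁ hb₁ g).1 hg y

end Independence

/-! ### Equivariant coverings, their quotients and normal covers. -/

section Covers

variable {V : Type u} {W : Type v} {Γ : SimpleGraph V} {G : Subgroup (Equiv.Perm V)}
  {Δ : Set (V × V)} {Γ' : SimpleGraph W} {G' : Subgroup (Equiv.Perm W)} {Δ' : Set (W × W)}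
  {F : V → W}

/-- `F` is a covering map of graphs along which the groups `G` and `G'` correspond. -/
structure IsEquivariantCovering (Γ : SimpleGraph V) (G : Subgroup (Equiv.Perm V))
    (Γ' : SimpleGraph W) (G' : Subgroup (Equiv.Perm W)) (F : V → W) : Prop where
  surjective : Function.Surjective F
  adj_map : ∀ {x y}, Γ.Adj x y → Γ'.Adj (F x) (F y)
  lift : ∀ {x w}, Γ'.Adj (F x) w → ∃! y, F y = w ∧ Γ.Adj x y
  push : ∀ g : G, ∃ p ∈ G', ∀ x, F (g • x) = p (F x)
  pull : ∀ p ∈ G', ∃ g : G, ∀ x, F (g • x) = p (F x)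

namespace IsEquivariantCovering

theorem adj_of_mem (hF : IsEquivariantCovering Γ G Γ' G' F) (h : IsOG4 Γ G Δ) {p : Equiv.Perm W}
    (hp : p ∈ G') {u v : W} (huv : Γ'.Adj u v) : Γ'.Adj (p u) (p v) := by
  obtain ⟨x, rfl⟩ := hF.surjective u
  obtain ⟨y, ⟨rfl, hxy⟩, -⟩ := hF.lift huv
  obtain ⟨g, hg⟩ := hF.pull p hp
  rw [← hg, ← hg]
  exact hF.adj_map ((h.smul_adj g).2 hxy)

theorem bijOn_neighborSet (hF : IsEquivariantCovering Γ G Γ' G' F) (x : V) :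
    Set.BijOn F (Γ.neighborSet x) (Γ'.neighborSet (F x)) := by
  refine ⟨fun y hy => hF.adj_map hy, fun y hy z hz hyz => ?_, fun w hw => ?_⟩
  · exact (hF.lift (hF.adj_map hz)).unique ⟨hyz, hy⟩ ⟨rfl, hz⟩
  · obtain ⟨y, ⟨hy, hxy⟩, -⟩ := hF.lift hw
    exact ⟨y, hxy, hy⟩

/-- Membership in `OG(4)` passes to the base of an equivariant covering. -/
theorem isOG4 (hF : IsEquivariantCovering Γ G Γ' G' F) (h : IsOG4 Γ G Δ)
    (hΔ : ∀ u v, (u, v) ∈ Δ' ↔ ∃ x y, F x = u ∧ F y = v ∧ (x, y) ∈ Δ)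
    (hanti : ∀ u v, (u, v) ∈ Δ' → (v, u) ∉ Δ') : IsOG4 Γ' G' Δ' where
  finite := have := h.finite; Finite.of_surjective F hF.surjective
  connected := h.connected.map ⟨F, hF.adj_map⟩ hF.surjective
  valency w := by
    obtain ⟨x, rfl⟩ := hF.surjective w
    rw [← (hF.bijOn_neighborSet x).image_eq, (hF.bijOn_neighborSet x).injOn.ncard_image,
      h.valency]
  automorphisms p hp u v := by
    refine ⟨fun huv => ?_, hF.adj_of_mem h hp⟩
    simpa using hF.adj_of_mem h (G'.inv_mem hp) huv
  vertex_transitive u v := by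
    obtain ⟨x, rfl⟩ := hF.surjective u
    obtain ⟨y, rfl⟩ := hF.surjective v
    obtain ⟨g, rfl⟩ := h.exists_smul_eq x y
    obtain ⟨p, hp, hg⟩ := hF.push g
    exact ⟨p, hp, (hg x).symm⟩
  edge_transitive e he e' he' := by
    induction e using Sym2.ind with | _ u v =>
    induction e' using Sym2.ind with | _ u' v' =>
    obtain ⟨x, rfl⟩ := hF.surjective u
    obtain ⟨x', rfl⟩ := hF.surjective u'
    obtain ⟨y, ⟨rfl, hxy⟩, -⟩ := hF.lift he
    obtain ⟨y', ⟨rfl, hxy'⟩, -⟩ := hF.lift he'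
    obtain ⟨g, hg, hge⟩ := h.edge_transitive s(x, y) hxy s(x', y') hxy'
    obtain ⟨p, hp, hpg⟩ := hF.push ⟨g, hg⟩
    refine ⟨p, hp, ?_⟩
    rw [Sym2.map_mk, ← hpg, ← hpg, ← Sym2.map_mk F, ← Sym2.map_mk F, ← hge]
    rfl
  orbit := by
    obtain ⟨x, y, hxy⟩ := h.orbit
    refine ⟨F x, F y, ?_⟩
    ext ⟨u, v⟩
    rw [hΔ, hxy]
    constructor
    · rintro ⟨x', y', rfl, rfl, g, hg, he⟩
      obtain ⟨rfl, rfl⟩ := Prod.mk.inj he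
      obtain ⟨p, hp, hpg⟩ := hF.push ⟨g, hg⟩
      exact ⟨p, hp, Prod.ext (hpg x) (hpg y)⟩
    · rintro ⟨p, hp, he⟩
      obtain ⟨rfl, rfl⟩ := Prod.mk.inj he
      obtain ⟨g, hg⟩ := hF.pull p hp
      exact ⟨g • x, g • y, hg x, hg y, g, g.2, rfl⟩
  adj_of_mem u v huv := by
    obtain ⟨x, y, rfl, rfl, hxy⟩ := (hΔ u v).1 huv
    exact hF.adj_map (h.adj_of_mem x y hxy)
  -- A covering alone might map two arcs to opposite arcs; `hanti` excludes this.
  one_per_edge u v huv := by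
    obtain ⟨x, rfl⟩ := hF.surjective u
    obtain ⟨y, ⟨rfl, hxy⟩, -⟩ := hF.lift huv
    rcases h.arc_or_arc hxy with h' | h'
    · have := (hΔ _ _).2 ⟨x, y, rfl, rfl, h'⟩
      exact Or.inl ⟨this, hanti _ _ this⟩
    · have := (hΔ _ _).2 ⟨y, x, rfl, rfl, h'⟩
      exact Or.inr ⟨this, hanti _ _ this⟩

/-- The homomorphism `G → G'` induced by an equivariant covering. -/
noncomputable def hom (hF : IsEquivariantCovering Γ G Γ' G' F) : G →* G' where
  toFun g := ⟨(hF.push g).choose, (hF.push g).choose_spec.1⟩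
  map_one' := by
    ext w
    obtain ⟨x, rfl⟩ := hF.surjective w
    change (hF.push 1).choose (F x) = F x
    rw [← (hF.push 1).choose_spec.2, one_smul]
  map_mul' g g' := by
    ext w
    obtain ⟨x, rfl⟩ := hF.surjective w
    change (hF.push (g * g')).choose (F x) = (hF.push g).choose ((hF.push g').choose (F x))
    rw [← (hF.push _).choose_spec.2, ← (hF.push _).choose_spec.2, ← (hF.push _).choose_spec.2,
      mul_smul]

theorem hom_apply (hF : IsEquivariantCovering Γ G Γ' G' F) (g : G) (x : V) :
    (hF.hom g : Equiv.Perm W) (F x) = F (g • x) :=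
  ((hF.push g).choose_spec.2 x).symm

theorem hom_surjective (hF : IsEquivariantCovering Γ G Γ' G' F) : Function.Surjective hF.hom := by
  rintro ⟨p, hp⟩
  obtain ⟨g, hg⟩ := hF.pull p hp
  refine ⟨g, ?_⟩
  ext w
  obtain ⟨x, rfl⟩ := hF.surjective w
  rw [hF.hom_apply, hg]

theorem mem_ker_hom_iff (hF : IsEquivariantCovering Γ G Γ' G' F) (g : G) :
    g ∈ hF.hom.ker ↔ ∀ x, F (g • x) = F x := by
  rw [MonoidHom.mem_ker]
  constructor
  · intro hg x
    rw [← hF.hom_apply, hg]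
    rfl
  · intro hg
    ext w
    obtain ⟨x, rfl⟩ := hF.surjective w
    rw [hF.hom_apply, hg]
    rfl

variable {T : Subgroup G}

/-- The isomorphism from the quotient graph by the fibres of an equivariant covering to its base. -/
noncomputable def quotientIso (hF : IsEquivariantCovering Γ G Γ' G' F)
    (hT : ∀ x y, F x = F y ↔ orb T x = orb T y) : quotientGraph Γ T ≃g Γ' where
  toEquiv := Equiv.ofBijective
    (Quotient.lift F fun x y hxy => (hT x y).2 (Quotient.sound hxy)) (by
      refine ⟨fun B C hBC => ?_, fun w => ?_⟩
      · induction B using Quotient.inductionOn with | _ x =>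
        induction C using Quotient.inductionOn with | _ y =>
        exact (hT x y).1 hBC
      · obtain ⟨x, rfl⟩ := hF.surjective w
        exact ⟨orb T x, rfl⟩)
  map_rel_iff' {B C} := by
    induction B using Quotient.inductionOn with | _ x =>
    induction C using Quotient.inductionOn with | _ y =>
    change Γ'.Adj (F x) (F y) ↔ (quotientGraph Γ T).Adj (orb T x) (orb T y)
    constructor
    · intro hxy
      obtain ⟨z, ⟨hz, hxz⟩, -⟩ := hF.lift hxy
      exact ⟨fun he => hxy.ne ((hT x y).2 he), x, z, rfl, (hT z y).1 hz, hxz⟩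
    · rintro ⟨-, x', y', hx', hy', hxy⟩
      rw [← (hT _ _).2 hx', ← (hT _ _).2 hy']
      exact hF.adj_map hxy

theorem quotientIso_orb (hF : IsEquivariantCovering Γ G Γ' G' F)
    (hT : ∀ x y, F x = F y ↔ orb T x = orb T y) (x : V) : hF.quotientIso hT (orb T x) = F x := rfl

/-- The second hypothesis identifies `T` with the kernel of the induced homomorphism `G → G'`. Thus
`T` is normal, and the first isomorphism theorem supplies the group part. -/
theorem isNormalCover (hF : IsEquivariantCovering Γ G Γ' G' F)
    (hT : ∀ x y, F x = F y ↔ orb T x = orb T y) (hmem : ∀ g, g ∈ T ↔ ∀ x, F (g • x) = F x) :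
    IsNormalCover Γ G Γ' G' := by
  obtain rfl : T = hF.hom.ker := by
    ext g
    rw [hmem, hF.mem_ker_hom_iff]
  refine ⟨hF.hom.ker, inferInstance, fun x C hC => ?_, hF.quotientIso hT,
    QuotientGroup.quotientKerEquivOfSurjective _ hF.hom_surjective, fun g x => ?_⟩
  · induction C using Quotient.inductionOn with | _ z =>
    rw [← (hF.quotientIso hT).map_adj_iff] at hC
    obtain ⟨y, ⟨hy, hxy⟩, huniq⟩ := hF.lift hC
    refine ⟨y, ⟨(hT y z).1 hy, hxy⟩, fun y' hy' => huniq y' ⟨(hT y' z).2 hy'.1, hy'.2⟩⟩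
  · rw [quotientIso_orb, quotientIso_orb]
    exact (hF.hom_apply g x).symm

/-- The quotient by the fibres of a covering of a 4-valent graph is not a cycle. -/
theorem not_isCycleQuotient (hF : IsEquivariantCovering Γ G Γ' G' F) (h : IsOG4 Γ' G' Δ')
    (hT : ∀ x y, F x = F y ↔ orb T x = orb T y) (k : ℕ) : ¬ IsCycleQuotient Γ T k := by
  rintro ⟨hk, ⟨e⟩⟩
  obtain ⟨n, rfl⟩ : ∃ n, k = n + 2 := ⟨k - 2, by omega⟩
  -- The base would itself be a cycle, but its vertices have four neighbours and those of a cycle at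
  -- most two.
  let e' : Γ' ≃g SimpleGraph.cycleGraph (n + 2) := (hF.quotientIso hT).symm.trans e
  obtain ⟨w⟩ := h.connected.nonempty
  have h4 := h.valency w
  rw [Set.ncard_congr' (SimpleGraph.Iso.mapNeighborSet e' w), SimpleGraph.cycleGraph_neighborSet] at h4
  have := Set.ncard_insert_le (e' w - 1) {e' w + 1}
  rw [Set.ncard_singleton, h4] at this
  omega

end IsEquivariantCovering

end Covers

end OG4

namespace OG4

universe u v

/-! ### Grid labellings: local bijectivity, image and the induced covering. -/

section Grid

variable {V : Type u} {W : Type v} {Γ : SimpleGraph V} {G : Subgroup (Equiv.Perm V)}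
  {Δ : Set (V × V)} {r s : ℕ} {F : V → ZMod r × ZMod s}

theorem gammaGraph_adj (hr : 3 ≤ r) {p q : ZMod r × ZMod s} : (gammaGraph r s).Adj p q ↔
    (q.1 = p.1 + 1 ∨ q.1 = p.1 - 1) ∧ (q.2 = p.2 + 1 ∨ q.2 = p.2 - 1) := by
  have h1 := one_ne_zero_of_three_le hr
  rw [gammaGraph, SimpleGraph.fromRel_adj]
  constructor
  · rintro ⟨-, h | h⟩
    · exact h
    · refine ⟨h.1.symm.imp ?_ ?_, h.2.symm.imp ?_ ?_⟩ <;> intro h <;> rw [h] <;> ring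
  · refine fun h => ⟨?_, Or.inl h⟩
    rintro rfl
    rcases h.1 with h | h
    · exact h1 (by linear_combination -h)
    · exact h1 (by linear_combination h)

/-- `F` combines an unoriented and an oriented cyclic labelling: arcs lead from `(i, j)` to
`(i ± 1, j + 1)`, and every vertex stabiliser induces a reflection in the first coordinate. -/
structure IsGridLabelling (G : Subgroup (Equiv.Perm V)) (Δ : Set (V × V))
    (F : V → ZMod r × ZMod s) : Prop where
  arc : ∀ x y, (x, y) ∈ Δ → (F x, F y) ∈ arrows r s
  act : ∀ g : G, ∃ (ε : ZMod r) (t : ZMod r × ZMod s), (ε = 1 ∨ ε = -1) ∧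
    ∀ x, F (g • x) = (ε * (F x).1, (F x).2) + t
  reflection : ∀ x, ∃ g : G, g • x = x ∧ ∀ y, F (g • y) = (2 * (F x).1 - (F y).1, (F y).2)

namespace IsGridLabelling

/-- The stabiliser element reflecting the first coordinate at `x` sends an out-neighbour with offset
`1` to one with offset `-1` and conversely, so both offsets occur. -/
theorem exists_out (hF : IsGridLabelling G Δ F) (h : IsOG4 Γ G Δ) (x : V) {e : ZMod r}
    (he : e = 1 ∨ e = -1) : ∃ y, (x, y) ∈ Δ ∧ F y = F x + (e, 1) := by
  obtain ⟨y, hxy⟩ := h.exists_out x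
  obtain ⟨g, hgx, hg⟩ := hF.reflection x
  have hgy := h.arc_smul g hxy
  rw [hgx] at hgy
  obtain ⟨h1, h2⟩ := hF.arc x y hxy
  dsimp only at h1 h2
  have hy : F y = F x + (e, 1) ∨ F (g • y) = F x + (e, 1) := by
    simp only [hg, Prod.ext_iff, Prod.fst_add, Prod.snd_add, h2]
    rcases h1 with h1 | h1 <;> rcases he with rfl | rfl <;> rw [h1]
    · exact Or.inl ⟨rfl, trivial⟩
    · exact Or.inr ⟨by ring, trivial⟩
    · exact Or.inr ⟨by ring, trivial⟩
    · exact Or.inl ⟨by ring, trivial⟩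
  rcases hy with hy | hy
  · exact ⟨y, hxy, hy⟩
  · exact ⟨g • y, hgy, hy⟩

theorem exists_in (hF : IsGridLabelling G Δ F) (h : IsOG4 Γ G Δ) (x : V) {e : ZMod r}
    (he : e = 1 ∨ e = -1) : ∃ y, (y, x) ∈ Δ ∧ F y = F x + (e, -1) := by
  obtain ⟨y, hxy⟩ := h.exists_in x
  obtain ⟨g, hgx, hg⟩ := hF.reflection x
  have hgy := h.arc_smul g hxy
  rw [hgx] at hgy
  obtain ⟨h1, h2⟩ := hF.arc y x hxy
  dsimp only at h1 h2
  have hy : F y = F x + (e, -1) ∨ F (g • y) = F x + (e, -1) := by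
    simp only [hg, Prod.ext_iff, Prod.fst_add, Prod.snd_add, h2]
    rcases h1 with h1 | h1 <;> rcases he with rfl | rfl <;> rw [h1]
    · exact Or.inr ⟨by ring, by ring⟩
    · exact Or.inl ⟨by ring, by ring⟩
    · exact Or.inl ⟨by ring, by ring⟩
    · exact Or.inr ⟨by ring, by ring⟩
  rcases hy with hy | hy
  · exact ⟨y, hxy, hy⟩
  · exact ⟨g • y, hgy, hy⟩

theorem adj_map (hF : IsGridLabelling G Δ F) (h : IsOG4 Γ G Δ) (hr : 3 ≤ r) {x y : V}
    (hxy : Γ.Adj x y) : (gammaGraph r s).Adj (F x) (F y) := by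
  rcases h.arc_or_arc hxy with h' | h'
  · exact (gammaGraph_adj hr).2 ((hF.arc _ _ h').imp id Or.inl)
  · exact ((gammaGraph_adj hr).2 ((hF.arc _ _ h').imp id Or.inl)).symm

theorem exists_lift (hF : IsGridLabelling G Δ F) (h : IsOG4 Γ G Δ) (hr : 3 ≤ r) {x : V}
    {w : ZMod r × ZMod s} (hw : (gammaGraph r s).Adj (F x) w) : ∃ y, F y = w ∧ Γ.Adj x y := by
  obtain ⟨h1, h2⟩ := (gammaGraph_adj hr).1 hw
  obtain ⟨e, he, hwe⟩ : ∃ e : ZMod r, (e = 1 ∨ e = -1) ∧ w.1 = (F x).1 + e := by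
    rcases h1 with h1 | h1
    · exact ⟨1, Or.inl rfl, h1⟩
    · exact ⟨-1, Or.inr rfl, by rw [h1]; ring⟩
  rcases h2 with h2 | h2
  · obtain ⟨y, hxy, hy⟩ := hF.exists_out h x he
    exact ⟨y, by rw [hy]; exact Prod.ext hwe.symm h2.symm, h.adj_of_mem _ _ hxy⟩
  · obtain ⟨y, hxy, hy⟩ := hF.exists_in h x he
    exact ⟨y, by rw [hy]; exact Prod.ext hwe.symm (by rw [h2, Prod.snd_add]; ring),
      (h.adj_of_mem _ _ hxy).symm⟩

/-- A count: four neighbours map onto four grid points, which are distinct because `2 ≠ 0` in both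
factors. -/
theorem injOn_neighborSet (hF : IsGridLabelling G Δ F) (h : IsOG4 Γ G Δ) (hr : 3 ≤ r)
    (hs : 3 ≤ s) (x : V) : Set.InjOn F (Γ.neighborSet x) := by
  have := h.finite
  have himage : F '' Γ.neighborSet x =
      ({(F x).1 + 1, (F x).1 - 1} : Set (ZMod r)) ×ˢ ({(F x).2 + 1, (F x).2 - 1} : Set (ZMod s)) := by
    ext w
    rw [Set.mem_prod, Set.mem_insert_iff, Set.mem_insert_iff, Set.mem_singleton_iff,
      Set.mem_singleton_iff, ← gammaGraph_adj hr]
    constructor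
    · rintro ⟨y, hy, rfl⟩
      exact hF.adj_map h hr hy
    · intro hw
      obtain ⟨y, hy, hxy⟩ := hF.exists_lift h hr hw
      exact ⟨y, hxy, hy⟩
  apply Set.injOn_of_ncard_image_eq
  rw [himage, Set.ncard_prod, Set.ncard_pair, Set.ncard_pair, h.valency]
  · exact fun he => two_ne_zero_of_three_le hs (by linear_combination he)
  · exact fun he => two_ne_zero_of_three_le hr (by linear_combination he)
  · exact Set.toFinite _

/-- Any two vertices are related by a group element inducing a translation of the labels. -/
theorem exists_translation (hF : IsGridLabelling G Δ F) (h : IsOG4 Γ G Δ) (x y : V) :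
    ∃ g : G, g • x = y ∧ ∀ z, F (g • z) = F z + (F y - F x) := by
  obtain ⟨g, rfl⟩ := h.exists_smul_eq x y
  obtain ⟨ε, t, rfl | rfl, hg⟩ := hF.act g
  · exact ⟨g, rfl, fun z => by rw [hg, hg]; ext <;> simp⟩
  -- If `g` reflects, composing it with a reflection fixing `x` cancels the sign without changing
  -- the image of `x`.
  · obtain ⟨g', hg'x, hg'⟩ := hF.reflection x
    refine ⟨g * g', by rw [mul_smul, hg'x], fun z => ?_⟩
    rw [mul_smul, hg, hg', hg]
    ext <;> simp
    ring

/-- Between vertices with equal labels, the element of `exists_translation` translates by zero and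
so lies in `T`. -/
theorem orb_eq_iff_of_mem_iff (hF : IsGridLabelling G Δ F) (h : IsOG4 Γ G Δ) {T : Subgroup G}
    (hT : ∀ g, g ∈ T ↔ ∀ x, F (g • x) = F x) (x y : V) : F x = F y ↔ orb T x = orb T y := by
  rw [orb_eq_iff]
  constructor
  · intro hxy
    obtain ⟨g, hg, hgF⟩ := hF.exists_translation h y x
    exact ⟨g, (hT g).2 fun z => by rw [hgF, hxy, sub_self, add_zero], hg⟩
  · rintro ⟨g, hg, rfl⟩
    exact (hT g).1 hg y

/-- The translations preserving the image of a grid labelling. -/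
def periods (F : V → ZMod r × ZMod s) : AddSubmonoid (ZMod r × ZMod s) where
  carrier := {t | ∀ x, ∃ y, F y = F x + t}
  zero_mem' x := ⟨x, by simp⟩
  add_mem' {t u} ht hu x := by
    obtain ⟨y, hy⟩ := ht x
    obtain ⟨z, hz⟩ := hu y
    exact ⟨z, by rw [hz, hy, add_assoc]⟩

theorem up_mem_periods (hF : IsGridLabelling G Δ F) (h : IsOG4 Γ G Δ) {e : ZMod r}
    (he : e = 1 ∨ e = -1) : (e, 1) ∈ periods F := fun x => by
  obtain ⟨y, -, hy⟩ := hF.exists_out h x he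
  exact ⟨y, hy⟩

theorem down_mem_periods (hF : IsGridLabelling G Δ F) (h : IsOG4 Γ G Δ) {e : ZMod r}
    (he : e = 1 ∨ e = -1) : (e, -1) ∈ periods F := fun x => by
  obtain ⟨y, -, hy⟩ := hF.exists_in h x he
  exact ⟨y, hy⟩

theorem two_zero_mem_periods (hF : IsGridLabelling G Δ F) (h : IsOG4 Γ G Δ) :
    (2, 0) ∈ periods F := by
  convert add_mem (hF.up_mem_periods h (Or.inl rfl)) (hF.down_mem_periods h (Or.inl rfl)) using 1
  ext <;> simp
  ring

theorem zero_two_mem_periods (hF : IsGridLabelling G Δ F) (h : IsOG4 Γ G Δ) :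
    (0, 2) ∈ periods F := by
  convert add_mem (hF.up_mem_periods h (Or.inl rfl)) (hF.up_mem_periods h (Or.inr rfl)) using 1
  ext <;> simp
  ring

end IsGridLabelling

theorem mem_of_units_mem [NeZero r] [NeZero s] {H : AddSubmonoid (ZMod r × ZMod s)}
    (h1 : (1, 0) ∈ H) (h2 : (0, 1) ∈ H) (w : ZMod r × ZMod s) : w ∈ H := by
  convert add_mem (nsmul_mem h1 w.1.val) (nsmul_mem h2 w.2.val) using 1
  ext <;> simp

theorem mem_of_sameParity [NeZero r] [NeZero s] (hr : Even r) (hs : Even s)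
    {H : AddSubmonoid (ZMod r × ZMod s)} (h1 : (1, 1) ∈ H) (h2 : (2, 0) ∈ H)
    {w : ZMod r × ZMod s} (hw : SameParity hr hs w) : w ∈ H := by
  obtain ⟨i, j⟩ := w
  have hij : i.val ≡ j.val [MOD 2] := by
    rw [← ZMod.natCast_eq_natCast_iff]
    have : ZMod.castHom hr.two_dvd (ZMod 2) i = ZMod.castHom hs.two_dvd (ZMod 2) j := hw
    rw [← ZMod.natCast_zmod_val i, ← ZMod.natCast_zmod_val j, map_natCast, map_natCast] at this
    exact this
  -- Adding `r * j` to `i` changes neither its class modulo `r` nor, `r` being even, its parity, and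
  -- makes the difference from `j` a natural number. Then `w = j • (1, 1) + n • (2, 0)`.
  have hle : j.val ≤ r * j.val := Nat.le_mul_of_pos_left _ (NeZero.pos r)
  obtain ⟨n, hn⟩ : ∃ n, i.val + r * j.val = j.val + 2 * n := by
    have hr2 : r * j.val % 2 = 0 := by
      rw [Nat.mul_mod, Nat.even_iff.1 hr, zero_mul, Nat.zero_mod]
    unfold Nat.ModEq at hij
    exact ⟨(i.val + r * j.val - j.val) / 2, by omega⟩
  have hn' : i = j.val + 2 * n := by
    have := congrArg (Nat.cast : ℕ → ZMod r) hn
    push_cast at this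
    simpa using this
  convert add_mem (nsmul_mem h1 j.val) (nsmul_mem h2 n) using 1
  ext
  · rw [Prod.fst_add, Prod.smul_fst, Prod.smul_fst, nsmul_eq_mul, nsmul_eq_mul, hn']
    ring
  · simp

namespace IsGridLabelling

theorem surjective_of_odd (hF : IsGridLabelling G Δ F) (h : IsOG4 Γ G Δ) (hr : 3 ≤ r)
    (hs : 3 ≤ s) (ho : Odd r ∨ Odd s) {x₀ : V} (h₀ : F x₀ = 0) : Function.Surjective F := by
  have : NeZero r := ⟨by omega⟩
  have : NeZero s := ⟨by omega⟩
  have hunits : (1, 0) ∈ periods F ∧ (0, 1) ∈ periods F := by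
    rcases ho with ⟨q, hq⟩ | ⟨q, hq⟩
    -- With `r = 2q + 1`, the period `(2, 0)` taken `q + 1` times is `(1, 0)` and taken `q` times is
    -- `(-1, 0)`; adding the latter to `(1, 1)` gives `(0, 1)`. The case of odd `s` is symmetric.
    · have hq' : (2 : ZMod r) * q + 1 = 0 := by
        have := congrArg (Nat.cast : ℕ → ZMod r) hq
        rw [ZMod.natCast_self] at this
        exact_mod_cast this.symm
      have e1 : (1, 0) ∈ periods F := by
        convert nsmul_mem (hF.two_zero_mem_periods h) (q + 1) using 1
        ext
        · rw [Prod.smul_fst, nsmul_eq_mul]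
          push_cast
          linear_combination -hq'
        · simp
      have e2 : (-1, 0) ∈ periods F := by
        convert nsmul_mem (hF.two_zero_mem_periods h) q using 1
        ext
        · rw [Prod.smul_fst, nsmul_eq_mul]
          linear_combination -hq'
        · simp
      refine ⟨e1, ?_⟩
      convert add_mem (hF.up_mem_periods h (Or.inl rfl)) e2 using 1
      ext <;> simp
    · have hq' : (2 : ZMod s) * q + 1 = 0 := by
        have := congrArg (Nat.cast : ℕ → ZMod s) hq
        rw [ZMod.natCast_self] at this
        exact_mod_cast this.symm
      have e1 : (0, 1) ∈ periods F := by
        convert nsmul_mem (hF.zero_two_mem_periods h) (q + 1) using 1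
        ext
        · simp
        · rw [Prod.smul_snd, nsmul_eq_mul]
          push_cast
          linear_combination -hq'
      have e2 : (0, -1) ∈ periods F := by
        convert nsmul_mem (hF.zero_two_mem_periods h) q using 1
        ext
        · simp
        · rw [Prod.smul_snd, nsmul_eq_mul]
          linear_combination -hq'
      refine ⟨?_, e1⟩
      convert add_mem (hF.up_mem_periods h (Or.inl rfl)) e2 using 1
      ext <;> simp
  intro w
  obtain ⟨y, hy⟩ := mem_of_units_mem hunits.1 hunits.2 w x₀
  exact ⟨y, by rw [hy, h₀, zero_add]⟩

theorem exists_eq_of_sameParity (hF : IsGridLabelling G Δ F) (h : IsOG4 Γ G Δ) (hr : 3 ≤ r)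
    (hs : 3 ≤ s) (hr2 : Even r) (hs2 : Even s) {x₀ : V} (h₀ : F x₀ = 0) {w : ZMod r × ZMod s}
    (hw : SameParity hr2 hs2 w) : ∃ x, F x = w := by
  have : NeZero r := ⟨by omega⟩
  have : NeZero s := ⟨by omega⟩
  obtain ⟨y, hy⟩ := mem_of_sameParity hr2 hs2 (hF.up_mem_periods h (Or.inl rfl))
    (hF.two_zero_mem_periods h) hw x₀
  exact ⟨y, by rw [hy, h₀, zero_add]⟩

/-- Each arc changes the parity of both coordinates, and the parities agree at `x₀`. -/
theorem sameParity (hF : IsGridLabelling G Δ F) (h : IsOG4 Γ G Δ) (hr2 : Even r) (hs2 : Even s)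
    {x₀ : V} (h₀ : F x₀ = 0) (x : V) : SameParity hr2 hs2 (F x) := by
  have hstep : ∀ x y, (x, y) ∈ Δ → (SameParity hr2 hs2 (F y) ↔ SameParity hr2 hs2 (F x)) := by
    intro x y hxy
    obtain ⟨h1, h2⟩ := hF.arc x y hxy
    dsimp only at h1 h2
    rw [SameParity, SameParity, h2, map_add, map_one]
    rcases h1 with h1 | h1 <;> rw [h1]
    · rw [map_add, map_one, add_left_inj]
    · rw [map_sub, map_one, sub_eq_add_neg, ZMod.neg_eq_self_mod_two, add_left_inj]
  refine h.arc_induction (x₀ := x₀) ?_ (fun x y hxy => (hstep x y hxy).2)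
    (fun x y hxy => (hstep x y hxy).1) x
  rw [h₀, SameParity]
  simp

variable {Γ' : SimpleGraph W} {G' : Subgroup (Equiv.Perm W)} {F' : V → W}
  {ι : W → ZMod r × ZMod s}

/-- Stated for an embedding `ι` of the base in the grid, to serve both `Γ(r,s)` and `Γ⁺(r,s)`. On
either side the group acts through the translations by labels in the image, with or without a
reflection of the first coordinate. Hence translations by labels of `W` suffice in `htrans`. -/
theorem isEquivariantCovering (hF : IsGridLabelling G Δ F) (h : IsOG4 Γ G Δ) (hr : 3 ≤ r)
    (hs : 3 ≤ s) {x₀ : V} (h₀ : F x₀ = 0) (hι : Function.Injective ι)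
    (hF' : ∀ x, ι (F' x) = F x) (hsurj : Function.Surjective F')
    (hadj : ∀ u v, Γ'.Adj u v ↔ (gammaGraph r s).Adj (ι u) (ι v))
    (htrans : ∀ w, ∃ p ∈ G', ∀ v, ι (p v) = ι v + ι w)
    (hrefl : ∃ p ∈ G', ∀ v, ι (p v) = (-(ι v).1, (ι v).2))
    (haff : ∀ p ∈ G', ∃ (ε : ZMod r) (t : ZMod r × ZMod s), (ε = 1 ∨ ε = -1) ∧
      ∀ v, ι (p v) = (ε * (ι v).1, (ι v).2) + t) :
    IsEquivariantCovering Γ G Γ' G' F' where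
  surjective := hsurj
  adj_map hxy := (hadj _ _).2 (by rw [hF', hF']; exact hF.adj_map h hr hxy)
  lift {x w} hw := by
    rw [hadj, hF'] at hw
    obtain ⟨y, hy, hxy⟩ := hF.exists_lift h hr hw
    refine ⟨y, ⟨hι (by rw [hF', hy]), hxy⟩, fun z hz => ?_⟩
    exact hF.injOn_neighborSet h hr hs x hz.2 hxy (by rw [hy, ← hF', hz.1])
  push g := by
    obtain ⟨ε, t, hε, hg⟩ := hF.act g
    -- As `x₀` has label zero, the translation part of `g` is the label of `g • x₀`, so it lies in
    -- the image of `ι`.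
    have ht : ι (F' (g • x₀)) = t := by
      rw [hF', hg, h₀]
      ext <;> simp
    obtain ⟨p, hp, hpt⟩ := htrans (F' (g • x₀))
    rw [ht] at hpt
    rcases hε with rfl | rfl
    · exact ⟨p, hp, fun x => hι (by rw [hpt, hF', hF', hg, one_mul])⟩
    · obtain ⟨q, hq, hqr⟩ := hrefl
      refine ⟨p * q, G'.mul_mem hp hq, fun x => hι ?_⟩
      rw [Equiv.Perm.mul_apply, hpt, hqr, hF', hF', hg, neg_one_mul]
  pull p hp := by
    obtain ⟨ε, t, hε, hpt⟩ := haff p hp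
    obtain ⟨y, hy⟩ := hsurj (p (F' x₀))
    have ht : F y = t := by
      rw [← hF', hy, hpt, hF', h₀]
      ext <;> simp
    obtain ⟨g, -, hg⟩ := hF.exists_translation h x₀ y
    rw [h₀, ht, sub_zero] at hg
    rcases hε with rfl | rfl
    · exact ⟨g, fun x => hι (by rw [hpt, hF', hF', hg, one_mul])⟩
    · obtain ⟨g', -, hg'⟩ := hF.reflection x₀
      refine ⟨g * g', fun x => hι ?_⟩
      rw [hpt, hF', hF', mul_smul, hg, hg', h₀]
      simp

theorem arrows_iff (hF : IsGridLabelling G Δ F) (h : IsOG4 Γ G Δ) (hι : Function.Injective ι)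
    (hF' : ∀ x, ι (F' x) = F x) (hsurj : Function.Surjective F') (u v : W) :
    (ι u, ι v) ∈ arrows r s ↔ ∃ x y, F' x = u ∧ F' y = v ∧ (x, y) ∈ Δ := by
  constructor
  · rintro ⟨h1, h2⟩
    dsimp only at h1 h2
    obtain ⟨x, rfl⟩ := hsurj u
    have : ∃ e : ZMod r, (e = 1 ∨ e = -1) ∧ ι v = F x + (e, 1) := by
      rw [hF'] at h1 h2
      rcases h1 with h1 | h1
      · exact ⟨1, Or.inl rfl, Prod.ext h1 h2⟩
      · exact ⟨-1, Or.inr rfl, Prod.ext (by rw [h1, Prod.fst_add]; ring) h2⟩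
    obtain ⟨e, he, hv⟩ := this
    obtain ⟨y, hxy, hy⟩ := hF.exists_out h x he
    exact ⟨x, y, rfl, hι (by rw [hF', hy, hv]), hxy⟩
  · rintro ⟨x, y, rfl, rfl, hxy⟩
    rw [hF', hF']
    exact hF.arc x y hxy

end IsGridLabelling

theorem arrows_asymm (hs : 3 ≤ s) {p q : ZMod r × ZMod s} (h : (p, q) ∈ arrows r s) :
    (q, p) ∉ arrows r s := by
  intro h'
  have h1 : q.2 = p.2 + 1 := h.2
  have h2 : p.2 = q.2 + 1 := h'.2
  exact two_ne_zero_of_three_le hs (by linear_combination -h1 - h2)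

theorem exists_gridLabelling (h : IsOG4 Γ G Δ) {N M : Subgroup G} (hN : N.Normal) (hM : M.Normal)
    (hNr : IsCycleQuotient Γ N r) (hMs : IsCycleQuotient Γ M s) (hNo : ¬ IsOrientedQuotient Δ N)
    (hMo : IsOrientedQuotient Δ M) : ∃ F : V → ZMod r × ZMod s, IsGridLabelling G Δ F ∧
      (∃ x₀, F x₀ = 0) ∧ ∀ g, g ∈ orbitKernel N ⊓ orbitKernel M ↔ ∀ x, F (g • x) = F x := by
  obtain ⟨a₀, ha₀⟩ := exists_cycleLabelling h hN hNr
  obtain ⟨b₀, hb₀⟩ := exists_cycleLabelling h hM hMs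
  obtain ⟨b₁, hb₁, hb₁f⟩ := hb₀.exists_forward h hMs.1 hMo
  obtain ⟨x₀, -⟩ := ha₀.surjective 0
  -- Both labellings are shifted to vanish at `x₀`, so that for even `r` and `s` the image is `X⁺`
  -- and not the opposite parity class.
  have ha := ha₀.mul_add (Or.inl rfl) (-a₀ x₀)
  have hb := hb₁.mul_add (Or.inl rfl) (-b₁ x₀)
  have hbf : ∀ x y, (x, y) ∈ Δ → 1 * b₁ y + -b₁ x₀ = 1 * b₁ x + -b₁ x₀ + 1 := by
    intro x y hxy
    rw [hb₁f x y hxy]; ring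
  refine ⟨fun x => (1 * a₀ x + -a₀ x₀, 1 * b₁ x + -b₁ x₀), ⟨?_, ?_, ?_⟩, ⟨x₀, ?_⟩, ?_⟩
  · exact fun x y hxy => ⟨ha.arc h hxy, hbf x y hxy⟩
  · intro g
    obtain ⟨ε, t, hε, hg⟩ := ha.act g
    obtain ⟨u, hu⟩ := hb.act_of_forward h hbf g
    exact ⟨ε, (t, u), hε, fun x => Prod.ext (hg x) (hu x)⟩
  · intro x
    obtain ⟨g, hgx, hg⟩ := ha.exists_reflection h hNr.1 hNo x
    obtain ⟨u, hu⟩ := hb.act_of_forward h hbf g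
    -- The reflecting element fixes `x`, so its translation of the oriented coordinate is zero.
    have hx := hu x
    rw [hgx, left_eq_add] at hx
    exact ⟨g, hgx, fun y => Prod.ext (hg y) ((hu y).trans (by rw [hx, add_zero]))⟩
  · ext <;> simp
  · intro g
    rw [mem_orbitKernel_inf_iff ha hb]
    exact forall_congr' fun x => Prod.mk_inj.symm

end Grid

end OG4

namespace OG4

universe u v

/-! ### The label actions of `G(r,s)` and `G⁺(r,s)`. -/

section Groups

variable {W : Type v} {r s : ℕ}

/-- The translations of `ℤ_r × ℤ_s` induced by elements of `G'` through the labelling `ι`. -/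
def translations (G' : Subgroup (Equiv.Perm W)) (ι : W → ZMod r × ZMod s) :
    AddSubmonoid (ZMod r × ZMod s) where
  carrier := {t | ∃ p ∈ G', ∀ v, ι (p v) = ι v + t}
  zero_mem' := ⟨1, G'.one_mem, fun v => by simp⟩
  add_mem' := by
    rintro t u ⟨p, hp, hpt⟩ ⟨q, hq, hqu⟩
    exact ⟨p * q, G'.mul_mem hp hq, fun v => by
      rw [Equiv.Perm.mul_apply, hpt, hqu, add_assoc, add_comm u]⟩

/-- Maps of this affine form are closed under composition and inversion, so the generators suffice.
-/
theorem affine_of_mem_closure {S : Set (Equiv.Perm W)} {ι : W → ZMod r × ZMod s}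
    (hS : ∀ p ∈ S, ∃ (ε : ZMod r) (t : ZMod r × ZMod s), (ε = 1 ∨ ε = -1) ∧
      ∀ v, ι (p v) = (ε * (ι v).1, (ι v).2) + t) {p : Equiv.Perm W}
    (hp : p ∈ Subgroup.closure S) : ∃ (ε : ZMod r) (t : ZMod r × ZMod s), (ε = 1 ∨ ε = -1) ∧
      ∀ v, ι (p v) = (ε * (ι v).1, (ι v).2) + t := by
  induction hp using Subgroup.closure_induction with
  | mem p hp => exact hS p hp
  | one => exact ⟨1, 0, Or.inl rfl, fun v => by simp⟩
  | mul p q _ _ hp hq =>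
    obtain ⟨ε, t, hε, hp⟩ := hp
    obtain ⟨δ, u, hδ, hq⟩ := hq
    refine ⟨ε * δ, (ε * u.1, u.2) + t, ?_, fun v => ?_⟩
    · rcases hε with rfl | rfl <;> rcases hδ with rfl | rfl <;> simp
    · rw [Equiv.Perm.mul_apply, hp, hq]
      ext
      · simp only [Prod.fst_add]; ring
      · simp only [Prod.snd_add]; ring
  | inv p _ hp =>
    obtain ⟨ε, t, hε, hp⟩ := hp
    have hεε : ε * ε = 1 := by rcases hε with rfl | rfl <;> ring
    refine ⟨ε, (-(ε * t.1), -t.2), hε, fun v => ?_⟩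
    have hv := hp (p⁻¹ v)
    rw [show p (p⁻¹ v) = v from p.apply_symm_apply v] at hv
    rw [hv]
    ext
    · simp only [Prod.fst_add]
      linear_combination -(ι (p⁻¹ v)).1 * hεε
    · simp only [Prod.snd_add]; ring

theorem mu_pow_apply (k : ℕ) (p : ZMod r × ZMod s) : (mu r s ^ k) p = (p.1 + k, p.2) := by
  induction k with
  | zero => simp
  | succ k ih =>
    rw [pow_succ', Equiv.Perm.mul_apply, ih]
    change (p.1 + k + 1, p.2) = _
    push_cast
    rw [add_assoc]

theorem groupG_affine {p : Equiv.Perm (ZMod r × ZMod s)} (hp : p ∈ groupG r s) :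
    ∃ (ε : ZMod r) (t : ZMod r × ZMod s), (ε = 1 ∨ ε = -1) ∧
      ∀ v, p v = (ε * v.1, v.2) + t := by
  refine affine_of_mem_closure (ι := id) ?_ hp
  rintro p (rfl | rfl | rfl)
  · exact ⟨1, (1, 0), Or.inl rfl, fun v => by simp [mu, Prod.ext_iff]⟩
  · exact ⟨1, (0, 1), Or.inl rfl, fun v => by simp [nu, Prod.ext_iff]⟩
  · exact ⟨-1, 0, Or.inr rfl, fun v => by simp [sigma]⟩

theorem mem_translations_groupG [NeZero r] [NeZero s] (w : ZMod r × ZMod s) :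
    w ∈ translations (groupG r s) id := by
  refine mem_of_units_mem (H := translations (groupG r s) id)
    ⟨mu r s, Subgroup.subset_closure (by simp), fun v => ?_⟩
    ⟨nu r s, Subgroup.subset_closure (by simp), fun v => ?_⟩ w
  · simp [mu, Prod.ext_iff]
  · simp [nu, Prod.ext_iff]

variable (hr : Even r) (hs : Even s)

theorem muSqPlus_val (v : PlusVertex hr hs) : (muSqPlus hr hs v).1 = v.1 + (2, 0) := by
  change (v.1.1 + 1 + 1, v.1.2) = _
  ext
  · simp only [Prod.fst_add]; ring
  · simp

theorem muNuPlus_val (v : PlusVertex hr hs) : (muNuPlus hr hs v).1 = v.1 + (1, 1) := rfl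

theorem sigmaPlus_val (v : PlusVertex hr hs) : (sigmaPlus hr hs v).1 = (-v.1.1, v.1.2) := rfl

theorem muSqPlus_pow_val (k : ℕ) (v : PlusVertex hr hs) :
    ((muSqPlus hr hs ^ k) v).1 = v.1 + (2 * (k : ZMod r), 0) := by
  induction k with
  | zero => simp
  | succ k ih =>
    rw [pow_succ', Equiv.Perm.mul_apply, muSqPlus_val, ih]
    ext
    · simp only [Prod.fst_add]; push_cast; ring
    · simp

theorem groupGPlus_affine {p : Equiv.Perm (PlusVertex hr hs)} (hp : p ∈ groupGPlus hr hs) :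
    ∃ (ε : ZMod r) (t : ZMod r × ZMod s), (ε = 1 ∨ ε = -1) ∧
      ∀ v, (p v).1 = (ε * v.1.1, v.1.2) + t := by
  refine affine_of_mem_closure (ι := Subtype.val) ?_ hp
  rintro p (rfl | rfl | rfl)
  · exact ⟨1, (2, 0), Or.inl rfl, fun v => by rw [muSqPlus_val, one_mul]⟩
  · exact ⟨1, (1, 1), Or.inl rfl, fun v => by rw [muNuPlus_val, one_mul]⟩
  · exact ⟨-1, 0, Or.inr rfl, fun v => by rw [sigmaPlus_val, neg_one_mul, add_zero]⟩

theorem mem_translations_groupGPlus [NeZero r] [NeZero s] (w : PlusVertex hr hs) :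
    w.1 ∈ translations (groupGPlus hr hs) Subtype.val :=
  mem_of_sameParity hr hs (H := translations (groupGPlus hr hs) Subtype.val)
    ⟨muNuPlus hr hs, Subgroup.subset_closure (by simp), muNuPlus_val hr hs⟩
    ⟨muSqPlus hr hs, Subgroup.subset_closure (by simp), muSqPlus_val hr hs⟩ w.2

end Groups

/-! ### Weak metacirculant structure of the two base graphs. -/

section Metacirculants

/-- The cycle is an orbit of `⟨ρ⟩`, whose size is the minimal period of `x`; the hypothesis says
that this period and `n` have the same multiples. -/
theorem ncard_sameCycle {W : Type v} [Finite W] {ρ : Equiv.Perm W} {n : ℕ} {x : W}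
    (hper : ∀ k : ℕ, (ρ ^ k) x = x ↔ n ∣ k) : {y | ρ.SameCycle x y}.ncard = n := by
  have : Fintype (MulAction.orbit (Subgroup.zpowers ρ) x) := Fintype.ofFinite _
  have horb : {y | ρ.SameCycle x y} = MulAction.orbit (Subgroup.zpowers ρ) x := by
    ext y
    rw [MulAction.mem_orbit_iff]
    constructor
    · rintro ⟨k, rfl⟩
      exact ⟨⟨ρ ^ k, k, rfl⟩, rfl⟩
    · rintro ⟨⟨_, k, rfl⟩, rfl⟩
      exact ⟨k, rfl⟩
  have hk : ∀ k : ℕ, Function.minimalPeriod (ρ • ·) x ∣ k ↔ n ∣ k := by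
    intro k
    rw [← Function.isPeriodicPt_iff_minimalPeriod_dvd, ← hper, Function.IsPeriodicPt,
      smul_iterate]
    rfl
  rw [horb, ← Nat.card_coe_set_eq, Nat.card_eq_fintype_card, ← MulAction.minimalPeriod_eq_card]
  exact Nat.dvd_antisymm ((hk n).2 dvd_rfl) ((hk _).1 dvd_rfl)

/-- Commuting automorphisms `ρ`, `lam` such that the cycles of `ρ` are the fibres of a map to `ℤ_m`
on which `lam` acts by adding one give a weak metacirculant. -/
theorem isWeakMetacirculant_of_fibration {W : Type v} {Γ : SimpleGraph W}
    {G : Subgroup (Equiv.Perm W)} {Δ : Set (W × W)} (h : IsOG4 Γ G Δ) {m n : ℕ} [NeZero m]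
    {ρ lam : Equiv.Perm W} (hρ : ρ ∈ G) (hlam : lam ∈ G) (hcomm : lam * ρ = ρ * lam)
    (π : W → ZMod m) (hπρ : ∀ x, π (ρ x) = π x) (hπlam : ∀ x, π (lam x) = π x + 1)
    (hfib : ∀ x y, π x = π y → ∃ k : ℕ, (ρ ^ k) x = y)
    (hper : ∀ x, ∀ k : ℕ, (ρ ^ k) x = x ↔ n ∣ k) : IsWeakMetacirculant Γ m n ρ lam := by
  have := h.finite
  have hpow : ∀ (k : ℕ) x, π ((lam ^ k) x) = π x + k := by
    intro k x
    induction k with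
    | zero => simp
    | succ k ih => rw [pow_succ', Equiv.Perm.mul_apply, hπlam, ih]; push_cast; ring
  have hsurj : Function.Surjective π := by
    obtain ⟨x⟩ := h.connected.nonempty
    exact fun j => ⟨(lam ^ (j - π x).val) x, by rw [hpow, ZMod.natCast_zmod_val]; ring⟩
  have hsame : ∀ x y, ρ.SameCycle x y ↔ π x = π y := by
    intro x y
    constructor
    · intro hxy
      obtain ⟨k, -, rfl⟩ := hxy.exists_pow_eq'
      clear hxy
      induction k with
      | zero => simp
      | succ k ih => rw [pow_succ', Equiv.Perm.mul_apply, hπρ, ih]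
    · intro hxy
      obtain ⟨k, hk⟩ := hfib x y hxy
      exact ⟨k, by rw [zpow_natCast, hk]⟩
  have hlen : ∀ x, {y | ρ.SameCycle x y}.ncard = n := fun x => ncard_sameCycle (hper x)
  -- The conjugation exponent is `1` because `ρ` and `lam` commute.
  refine ⟨h.finite, h.automorphisms ρ hρ, h.automorphisms lam hlam, ?_, ?_, hlen, ?_, 1,
    Nat.coprime_one_left n, by rw [hcomm, mul_inv_cancel_right, pow_one]⟩
  · have hfibre : ∀ j, Nat.card {x // π x = j} = n := by
      intro j
      obtain ⟨x, rfl⟩ := hsurj j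
      rw [← hlen x]
      simp only [hsame]
      rw [← Nat.card_coe_set_eq]
      exact Nat.card_congr (Equiv.subtypeEquivRight fun y => eq_comm)
    rw [← Nat.card_congr (Equiv.sigmaFiberEquiv π), Nat.card_sigma]
    simp [hfibre, ZMod.card]
  · let f : Quotient (Equiv.Perm.SameCycle.setoid ρ) → ZMod m :=
      Quotient.lift π fun x y hxy => (hsame x y).1 hxy
    have hf : Function.Bijective f := by
      refine ⟨fun B C hBC => ?_, fun j => ?_⟩
      · induction B using Quotient.inductionOn with | _ x =>
        induction C using Quotient.inductionOn with | _ y =>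
        exact Quotient.sound ((hsame x y).2 hBC)
      · obtain ⟨x, rfl⟩ := hsurj j
        exact ⟨Quotient.mk _ x, rfl⟩
    rw [Nat.card_eq_of_bijective f hf, Nat.card_zmod]
  · intro x y
    refine ⟨((π y - π x).val : ℕ), (hsame _ _).2 ?_⟩
    rw [zpow_natCast, hpow, ZMod.natCast_zmod_val]
    ring

variable {r s : ℕ}

theorem isWeakMetacirculant_gammaGraph [NeZero r] [NeZero s]
    (h : IsOG4 (gammaGraph r s) (groupG r s) (arrows r s)) :
    IsWeakMetacirculant (gammaGraph r s) s r (mu r s) (nu r s) := by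
  refine isWeakMetacirculant_of_fibration h (Subgroup.subset_closure (by simp))
    (Subgroup.subset_closure (by simp)) rfl Prod.snd (fun _ => rfl) (fun _ => rfl) ?_ ?_
  · intro x y hxy
    refine ⟨(y.1 - x.1).val, ?_⟩
    rw [mu_pow_apply, ZMod.natCast_zmod_val]
    exact Prod.ext (by ring) hxy
  · intro x k
    rw [mu_pow_apply, ← ZMod.natCast_eq_zero_iff, Prod.ext_iff]
    simp

theorem isWeakMetacirculant_gammaPlus [NeZero r] [NeZero s] (hr : Even r) (hs : Even s)
    (h : IsOG4 (gammaPlus hr hs) (groupGPlus hr hs) (arrowsPlus hr hs)) :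
    IsWeakMetacirculant (gammaPlus hr hs) s (r / 2) (muSqPlus hr hs) (muNuPlus hr hs) := by
  refine isWeakMetacirculant_of_fibration h (Subgroup.subset_closure (by simp))
    (Subgroup.subset_closure (by simp)) rfl (fun v => v.1.2) (fun _ => rfl) (fun _ => rfl) ?_ ?_
  · intro x y hxy
    -- Points of `X⁺` with equal second coordinate have first coordinates of the same parity, so a
    -- power of `μ²` joins them.
    have hpar : ZMod.castHom hr.two_dvd (ZMod 2) (y.1.1 - x.1.1) = 0 := by
      have hx : ZMod.castHom hr.two_dvd (ZMod 2) x.1.1 = ZMod.castHom hs.two_dvd (ZMod 2) x.1.2 :=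
        x.2
      have hy : ZMod.castHom hr.two_dvd (ZMod 2) y.1.1 = ZMod.castHom hs.two_dvd (ZMod 2) y.1.2 :=
        y.2
      rw [map_sub, hx, hy, hxy, sub_self]
    rw [← ZMod.natCast_zmod_val (y.1.1 - x.1.1), map_natCast, ZMod.natCast_eq_zero_iff] at hpar
    obtain ⟨k, hk⟩ := hpar
    refine ⟨k, Subtype.ext ?_⟩
    have hk' : y.1.1 - x.1.1 = 2 * k := by
      rw [← ZMod.natCast_zmod_val (y.1.1 - x.1.1), hk]
      push_cast
      rfl
    rw [muSqPlus_pow_val, ← hk']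
    exact Prod.ext (by simp) (by simpa using hxy)
  · intro x k
    have h2 : (2 * (k : ZMod r) = 0) ↔ r / 2 ∣ k := by
      have : (2 * (k : ZMod r)) = ((2 * k : ℕ) : ZMod r) := by push_cast; rfl
      rw [this, ZMod.natCast_eq_zero_iff]
      obtain ⟨q, rfl⟩ := hr.two_dvd
      rw [Nat.mul_div_cancel_left q two_pos]
      exact Nat.mul_dvd_mul_iff_left two_pos
    rw [← h2, Subtype.ext_iff, muSqPlus_pow_val, Prod.ext_iff]
    simp

end Metacirculants

/-! ### The covering theorem and the choice of quotients. -/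

section Main

variable {V : Type u} {Γ : SimpleGraph V} {G : Subgroup (Equiv.Perm V)} {Δ : Set (V × V)}

/-- A pair in `OG(4)` with an unoriented cyclic normal quotient `Γ_N ≅ C_r` and an oriented one
`Γ_M ≅ C_s` is a normal cover of `Γ(r,s)` or `Γ⁺(r,s)`, and the two quotients are independent. -/
theorem normalCover_of_unoriented_of_oriented (h : IsOG4 Γ G Δ) {N M : Subgroup G}
    (hN : N.Normal) (hM : M.Normal) {r s : ℕ} (hNr : IsCycleQuotient Γ N r)
    (hMs : IsCycleQuotient Γ M s) (hNo : ¬ IsOrientedQuotient Δ N)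
    (hMo : IsOrientedQuotient Δ M) : AreIndependent Γ N M ∧
      (((Odd r ∨ Odd s) ∧ IsOG4 (gammaGraph r s) (groupG r s) (arrows r s) ∧
          IsNormalCover Γ G (gammaGraph r s) (groupG r s) ∧
          IsWeakMetacirculant (gammaGraph r s) s r (mu r s) (nu r s)) ∨
        ∃ (hr : Even r) (hs : Even s),
          IsOG4 (gammaPlus hr hs) (groupGPlus hr hs) (arrowsPlus hr hs) ∧
          IsNormalCover Γ G (gammaPlus hr hs) (groupGPlus hr hs) ∧
          IsWeakMetacirculant (gammaPlus hr hs) s (r / 2) (muSqPlus hr hs) (muNuPlus hr hs)) := by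
  obtain ⟨F, hF, ⟨x₀, h₀⟩, hT⟩ := exists_gridLabelling h hN hM hNr hMs hNo hMo
  have hr3 := hNr.1
  have hs3 := hMs.1
  have : NeZero r := ⟨by omega⟩
  have : NeZero s := ⟨by omega⟩
  have horb := hF.orb_eq_iff_of_mem_iff h hT
  by_cases hodd : Odd r ∨ Odd s
  · have hsurj := hF.surjective_of_odd h hr3 hs3 hodd h₀
    have hcov : IsEquivariantCovering Γ G (gammaGraph r s) (groupG r s) F :=
      hF.isEquivariantCovering h hr3 hs3 h₀ (ι := id) Function.injective_id (fun _ => rfl) hsurj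
        (fun _ _ => Iff.rfl) (fun w => mem_translations_groupG w)
        ⟨sigma r s, Subgroup.subset_closure (by simp), fun _ => rfl⟩ (fun p hp => groupG_affine hp)
    have hOG : IsOG4 (gammaGraph r s) (groupG r s) (arrows r s) :=
      hcov.isOG4 h (hF.arrows_iff h Function.injective_id (fun _ => rfl) hsurj)
        (fun _ _ => arrows_asymm hs3)
    -- Independence holds because the orbits of the kernel intersection are the fibres of `F`, with
    -- 4-valent quotient.
    exact ⟨fun ⟨k, hk⟩ => hcov.not_isCycleQuotient hOG horb k hk,
      Or.inl ⟨hodd, hOG, hcov.isNormalCover horb hT, isWeakMetacirculant_gammaGraph hOG⟩⟩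
  · rw [not_or, Nat.not_odd_iff_even, Nat.not_odd_iff_even] at hodd
    obtain ⟨hr, hs⟩ := hodd
    let F' : V → PlusVertex hr hs := fun x => ⟨F x, hF.sameParity h hr hs h₀ x⟩
    have hF' : ∀ x y, F' x = F' y ↔ F x = F y := fun x y => Subtype.ext_iff
    have hsurj : Function.Surjective F' := fun w => by
      obtain ⟨x, hx⟩ := hF.exists_eq_of_sameParity h hr3 hs3 hr hs h₀ w.2
      exact ⟨x, Subtype.ext hx⟩
    have hcov : IsEquivariantCovering Γ G (gammaPlus hr hs) (groupGPlus hr hs) F' :=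
      hF.isEquivariantCovering h hr3 hs3 h₀ (ι := Subtype.val) Subtype.val_injective
        (fun _ => rfl) hsurj (fun _ _ => Iff.rfl) (mem_translations_groupGPlus hr hs)
        ⟨sigmaPlus hr hs, Subgroup.subset_closure (by simp), sigmaPlus_val hr hs⟩
        (fun p hp => groupGPlus_affine hr hs hp)
    have hOG : IsOG4 (gammaPlus hr hs) (groupGPlus hr hs) (arrowsPlus hr hs) :=
      hcov.isOG4 h (hF.arrows_iff h Subtype.val_injective (fun _ => rfl) hsurj)
        (fun _ _ => arrows_asymm hs3)
    have horb' := fun x y => (hF' x y).trans (horb x y)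
    exact ⟨fun ⟨k, hk⟩ => hcov.not_isCycleQuotient hOG horb' k hk,
      Or.inr ⟨hr, hs, hOG, hcov.isNormalCover horb' (fun g => (hT g).trans
        (forall_congr' fun x => (hF' _ _).symm)), isWeakMetacirculant_gammaPlus hr hs hOG⟩⟩

/-- Quotient graphs depend only on orbits. This replaces `⟨ρ⟩`, which need not be normal, by a
normal subgroup with the same orbits. -/
theorem IsCycleQuotient.of_sameOrbits {R L : Subgroup G} (hRL : SameOrbits R L) {k : ℕ}
    (h : IsCycleQuotient Γ R k) : IsCycleQuotient Γ L k := by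
  refine ⟨h.1, h.2.map fun e => RelIso.trans (RelIso.symm ?_) e⟩
  refine ⟨Quotient.congrRight fun x y => ?_, ?_⟩
  · have := hRL x y
    simp only [orb, Quotient.eq] at this
    exact this
  · intro B C
    induction B using Quotient.inductionOn with | _ x =>
    induction C using Quotient.inductionOn with | _ y =>
    change (orb L x ≠ orb L y ∧ ∃ x' y', orb L x' = orb L x ∧ orb L y' = orb L y ∧ Γ.Adj x' y') ↔
      (orb R x ≠ orb R y ∧ ∃ x' y', orb R x' = orb R x ∧ orb R y' = orb R y ∧ Γ.Adj x' y')
    simp only [ne_eq, hRL _ _]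

theorem IsOrientedQuotient.of_sameOrbits {R L : Subgroup G} (hRL : SameOrbits R L)
    (h : IsOrientedQuotient Δ R) : IsOrientedQuotient Δ L := fun x y x' y' hxy hx hy =>
  h x y x' y' (fun he => hxy ((hRL x y).1 he)) ((hRL _ _).2 hx) ((hRL _ _).2 hy)

end Main

end OG4

theorem corollary1p5 {V : Type*} (Γ : SimpleGraph V) (G : Subgroup (Equiv.Perm V))
    (Δ : Set (V × V)) (hOG : IsOG4 Γ G Δ)
    -- `Γ` is a weak `(m,n)`-metacirculant relative to `(ρ, lam)`, with `ρ, lam ∈ G`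
    (m n : ℕ) (ρ lam : G) (hwm : IsWeakMetacirculant Γ m n ρ lam)
    -- `Γ_R`, `R = ⟨ρ⟩`, is a cyclic `G`-oriented normal quotient, of length `m ≥ 3`
    (hR : ∃ L : Subgroup G, L.Normal ∧ SameOrbits (Subgroup.zpowers ρ) L)
    (hRcycle : IsCycleQuotient Γ (Subgroup.zpowers ρ) m)
    (hRoriented : IsOrientedQuotient Δ (Subgroup.zpowers ρ))
    -- `Γ_N ≅ C_r`, `Γ_M ≅ C_s` are independent cyclic normal quotients
    (N M : Subgroup G) (hNnormal : N.Normal) (hMnormal : M.Normal) (r s : ℕ)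
    (hN : IsCycleQuotient Γ N r) (hM : IsCycleQuotient Γ M s) (hind : AreIndependent Γ N M) :
    -- there are independent cyclic normal quotients, `Γ_N' ≅ C_r'` unoriented and
    -- `Γ_M' ≅ C_s'` oriented, which are the given two whenever one of those is oriented
    ∃ (N' M' : Subgroup G) (r' s' : ℕ), N'.Normal ∧ M'.Normal ∧
      IsCycleQuotient Γ N' r' ∧ IsCycleQuotient Γ M' s' ∧ AreIndependent Γ N' M' ∧
      ¬ IsOrientedQuotient Δ N' ∧ IsOrientedQuotient Δ M' ∧
      (IsOrientedQuotient Δ M → N' = N ∧ M' = M) ∧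
      (IsOrientedQuotient Δ N → N' = M ∧ M' = N) ∧
      -- such that one of the two lines of the table holds for `r'`, `s'`
      (((Odd r' ∨ Odd s') ∧
          IsOG4 (gammaGraph r' s') (groupG r' s') (arrows r' s') ∧
          IsNormalCover Γ G (gammaGraph r' s') (groupG r' s') ∧
          IsWeakMetacirculant (gammaGraph r' s') s' r' (mu r' s') (nu r' s')) ∨
        ∃ (hr : Even r') (hs : Even s'),
          IsOG4 (gammaPlus hr hs) (groupGPlus hr hs) (arrowsPlus hr hs) ∧
          IsNormalCover Γ G (gammaPlus hr hs) (groupGPlus hr hs) ∧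
          IsWeakMetacirculant (gammaPlus hr hs) s' (r' / 2) (muSqPlus hr hs) (muNuPlus hr hs)) := by
  by_cases hMo : IsOrientedQuotient Δ M
  · have hNo : ¬ IsOrientedQuotient Δ N := fun hNo =>
      not_areIndependent_of_oriented hOG hNnormal hMnormal hN hM hNo hMo hind
    obtain ⟨h1, h2⟩ :=
      normalCover_of_unoriented_of_oriented hOG hNnormal hMnormal hN hM hNo hMo
    exact ⟨N, M, r, s, hNnormal, hMnormal, hN, hM, h1, hNo, hMo, fun _ => ⟨rfl, rfl⟩,
      fun h => absurd h hNo, h2⟩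
  by_cases hNo : IsOrientedQuotient Δ N
  · obtain ⟨h1, h2⟩ :=
      normalCover_of_unoriented_of_oriented hOG hMnormal hNnormal hM hN hMo hNo
    exact ⟨M, N, s, r, hMnormal, hNnormal, hM, hN, h1, hMo, hNo, fun h => absurd h hMo,
      fun _ => ⟨rfl, rfl⟩, h2⟩
  -- Neither given quotient is oriented: `N` is kept and paired with the oriented quotient by `⟨ρ⟩`,
  -- and both clauses about the given pair hold vacuously.
  obtain ⟨L, hL, hRL⟩ := hR
  obtain ⟨h1, h2⟩ := normalCover_of_unoriented_of_oriented hOG hNnormal hL hN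
    (hRcycle.of_sameOrbits hRL) hNo (hRoriented.of_sameOrbits hRL)
  exact ⟨N, L, r, m, hNnormal, hL, hN, hRcycle.of_sameOrbits hRL, h1, hNo,
    hRoriented.of_sameOrbits hRL, fun h => absurd h hMo, fun h => absurd h hNo, h2⟩
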